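/- **Setting.** Let $\mathcal U$, $P$, $\mathcal F$ be real Banach spaces, $F:\mathcal U\times P\to\mathcal F$, $g:\mathcal U\times P\to\mathbb R$, and suppose that for each $p\in P$ the equation $F(u,p)=0$ has the unique solution $u=U(p)$. The partial Fréchet derivatives of $F$ and $g$ in $u$ and in $p$ exist at every point, $U$ is differentiable, and $\frac{\partial F}{\partial u}[U(p),p]$ is boundedly invertible for every $p$. Fix $d$, points $p_1,\dots,p_d\in P$ (not necessarily distinct) and $M\in\mathbb R$. For a separable real Hilbert space $\mathcal H$, a Gaussian measure $\mathcal N(a,C)$ on $\mathcal H$ with positive-definite covariance operator $C$, a bounded linear $\mathcal I:\mathcal H\to\mathbb R^d$ with linearly independent components and $f\in\mathbb R^d$ (Euclidean norm), the posterior given $\mathcal I x=f$ is $\mathcal N(\bar a,\bar C)$, with $\bar a=a+C\mathcal I^*G^{-1}(f-\mathcal I a)$, $\bar C=C-C\mathcal I^*G^{-1}\mathcal I C$, $G=\mathcal I C\mathcal I^*$. For a second operator $\hat{\mathcal I}$, with $\hat G=\hat{\mathcal I}C\hat{\mathcal I}^*$ invertible, put (operator norms unless indicated) $$C_{\mathcal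 I,1}=\|C\|\Big[\big(\|a\|+\|C\|_{\mathsf{HS}}^{1/2}\big)\big(\|G^{-1}\mathcal I\|+\|\hat G^{-1}\hat{\mathcal I}\|\big)+\|G^{-1}f\|\Big],\qquad C_f=\|C\|\,\|G^{-1}\hat{\mathcal I}\|,$$ $$C_{\mathcal I,2}=\alpha\|C\|\Big(\|G^{-1}\|\,\|\hat{\mathcal I}\|\,\|G^{-1}f\|+\|G^{-1}\|^2\|\mathcal I\|\,\|\hat{\mathcal I}\|\big(\|a\|+\|C\|_{\mathsf{HS}}^{1/2}\big)\Big),\qquad \alpha=\|\mathcal I C\|+\|\hat{\mathcal I}C\|,$$ where $\|C\|_{\mathsf{HS}}$ is the Hilbert–Schmidt norm. $W_2$ is the 2-Wasserstein distance on $\mathcal H$ for the norm of $\mathcal H$. *Forward method.* $\mathcal H$ is a Hilbert space of functions $x:P\to\mathcal L(P,\mathcal U)$ with continuous point evaluations, normed so that $\|x(p_j)\|_{P\to\mathcal U}\le\|x\|_{\mathcal H}$ for all $j$; $\tilde{\mathcal I}_{F,j}\in\mathcal L(P,\mathcal F)^*$ with $\|\tilde{\mathcal I}_{F,j}\|<M$;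 and $$\mathcal I_{F,j}x=\tilde{\mathcal I}_{F,j}\Big(\tfrac{\partial F}{\partial u}[U(p_j),p_j]\,x(p_j)\Big),\qquad f_{F,j}=-\tilde{\mathcal I}_{F,j}\tfrac{\partial F}{\partial p}[U(p_j),p_j].$$ *Adjoint method.* $\mathcal F$ is moreover a Hilbert space; $\mathcal H$ is a Hilbert space of functions $\beta:P\to\mathcal F$ with continuous point evaluations, normed so that $\|\beta(p_j)\|_{\mathcal F}\le\|\beta\|_{\mathcal H}$ for all $j$; $e_1,\dots,e_d\in\mathcal U$ with $\|e_j\|<M$ (that is, the observation functionals $\ell\mapsto\ell(e_j)$ on $\mathcal U^*$ have norm less than $M$); and $$\mathcal I_{A,j}\beta=\Big\langle\tfrac{\partial F}{\partial u}[U(p_j),p_j](e_j),\,\beta(p_j)\Big\rangle_{\mathcal F},\qquad f_{A,j}=\tfrac{\partial g}{\partial u}[U(p_j),p_j](e_j).$$ In each method fix a prior $\mathcal N(a,C)$ on the respective $\mathcal H$ as above, assume that the information functionals are linearly independent, and let $\bar\mu_F$, $\bar\mu_A$ be the posteriors. For a map $\hat U:P\to\mathcal U$ let $\hat\mu_F$,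 $\hat\mu_A$ be the posteriors obtained with $\hat U$ in place of $U$, in both the functionals ($\hat{\mathcal I}$) and the data ($\hat f$); the constants above are taken with these $\mathcal I,\hat{\mathcal I}$ and $f$. **Claim.** The posteriors $\bar\mu_F,\bar\mu_A$ exist, and in each method there are $K$ and $\varepsilon_0>0$ such that, for all $0<\varepsilon<\varepsilon_0$ and every $\hat U:P\to\mathcal U$ with $$\Big\|\tfrac{\partial F}{\partial u}[U(p),p]-\tfrac{\partial F}{\partial u}[\hat U(p),p]\Big\|\le\varepsilon,\quad \Big\|\tfrac{\partial F}{\partial p}[U(p),p]-\tfrac{\partial F}{\partial p}[\hat U(p),p]\Big\|\le\varepsilon,\quad \Big\|\tfrac{\partial g}{\partial u}[U(p),p]-\tfrac{\partial g}{\partial u}[\hat U(p),p]\Big\|\le\varepsilon$$ at the points $p=p_1,\dots,p_d$, the operator $\hat G$ is invertible, the approximate posterior exists, and, for the forward and the adjoint method respectively, $$W_2(\bar\mu_F,\hat\mu_F)\le(C_{\mathcal I,1}+C_{\mathcal I,2}+C_f)M\varepsilon\sqrt d+K\varepsilon^2,$$ $$W_2(\bar\mu_A,\hat\mu_A)\le(C_{\mathcal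 I,1}+C_{\mathcal I,2}+C_f)M\varepsilon\sqrt d+K\varepsilon^2,\qquad W_2^2(\bar\mu_A,\hat\mu_A)\le(C_{\mathcal I,1}+C_{\mathcal I,2}+C_f)M\varepsilon\sqrt d+K\varepsilon^2 .$$ -/

import Mathlib

open MeasureTheory ProbabilityTheory
open scoped ENNReal RealInnerProductSpace

noncomputable section

namespace ProbSens

/-! ### Partial derivatives and the sensitivity problem -/

section Problem

variable {𝒰 P ℱ : Type*} [NormedAddCommGroup 𝒰] [NormedSpace ℝ 𝒰]
  [NormedAddCommGroup P] [NormedSpace ℝ P] [NormedAddCommGroup ℱ] [NormedSpace ℝ ℱ]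

/-- The partial Fréchet derivative `∂F/∂u [u, p]`. -/
def partialU (F : 𝒰 → P → ℱ) (u : 𝒰) (p : P) : 𝒰 →L[ℝ] ℱ := fderiv ℝ (fun v => F v p) u

/-- The partial Fréchet derivative `∂F/∂p [u, p]`. -/
def partialP (F : 𝒰 → P → ℱ) (u : 𝒰) (p : P) : P →L[ℝ] ℱ := fderiv ℝ (fun q => F u q) p

/-- The setting of local sensitivity analysis: `U p` is the unique solution `u` of `F(u, p) = 0`,
the partial derivatives of the constraint function `F` and of the real quantity of interest `g`
exist everywhere, the parameter-to-solution map `U` is differentiable, and `∂F/∂u [U(p), p]` is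
nonsingular. -/
structure IsSensitivityProblem (F : 𝒰 → P → ℱ) (g : 𝒰 → P → ℝ) (U : P → 𝒰) : Prop where
  solves : ∀ p, F (U p) p = 0
  unique : ∀ p u, F u p = 0 → u = U p
  diff_F_u : ∀ u p, DifferentiableAt ℝ (fun v => F v p) u
  diff_F_p : ∀ u p, DifferentiableAt ℝ (fun q => F u q) p
  diff_g_u : ∀ u p, DifferentiableAt ℝ (fun v => g v p) u
  diff_g_p : ∀ u p, DifferentiableAt ℝ (fun q => g u q) p
  diff_U : Differentiable ℝ U
  nonsingular : ∀ p, (partialU F (U p) p).IsInvertible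

/-- At the parameter `p`, the derivatives `∂F/∂u`, `∂F/∂p`, `∂g/∂u` evaluated at `U(p)` and at the
approximation `Û(p)` differ by at most `ε` in operator norm. -/
structure DerivClose (F : 𝒰 → P → ℱ) (g : 𝒰 → P → ℝ) (U Uhat : P → 𝒰) (ε : ℝ) (p : P) :
    Prop where
  F_u : ‖partialU F (U p) p - partialU F (Uhat p) p‖ ≤ ε
  F_p : ‖partialP F (U p) p - partialP F (Uhat p) p‖ ≤ ε
  g_u : ‖partialU g (U p) p - partialU g (Uhat p) p‖ ≤ ε

end Problem

/-! ### Gaussian measures on a Hilbert space and the Wasserstein distance -/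

/-- `μ = 𝒩(a, C)`: `μ` is a Gaussian Borel measure with mean `a` and covariance operator `C`. -/
structure IsNormal {H : Type*} [NormedAddCommGroup H] [InnerProductSpace ℝ H] [CompleteSpace H]
    [MeasurableSpace H] [BorelSpace H] (μ : Measure H) (a : H) (C : H →L[ℝ] H) : Prop where
  gaussian : IsGaussian μ
  mean : ∫ x, x ∂μ = a
  cov : ∀ x y, covarianceBilin μ x y = ⟪x, C y⟫

/-- The law `𝒩(a, C)` is determined by `a` and `C`. -/
theorem IsNormal.eq {H : Type*} [NormedAddCommGroup H] [InnerProductSpace ℝ H] [CompleteSpace H]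
    [SecondCountableTopology H] [MeasurableSpace H] [BorelSpace H] {μ ν : Measure H} {a : H}
    {C : H →L[ℝ] H} (hμ : IsNormal μ a C) (hν : IsNormal ν a C) : μ = ν := by
  have := hμ.gaussian
  have := hν.gaussian
  refine IsGaussian.ext (by simpa using hμ.mean.trans hν.mean.symm) ?_
  ext x y
  rw [hμ.cov, hν.cov]

/-- The 2-Wasserstein distance: the square root of the infimum of `∫ ‖v - v'‖² dπ(v, v')` over all
couplings `π` of `μ` and `ν`. -/
def W2 {V : Type*} [NormedAddCommGroup V] [MeasurableSpace V] (μ ν : Measure V) : ℝ≥0∞ :=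
  (⨅ π ∈ {π : Measure (V × V) | π.map Prod.fst = μ ∧ π.map Prod.snd = ν},
    ∫⁻ z, ‖z.1 - z.2‖ₑ ^ 2 ∂π) ^ (1 / 2 : ℝ)

/-! ### Conditioning a Gaussian measure on finitely many linear observations -/

/-- The operator `x ↦ (L₁ x, …, L_d x)` into `ℝᵈ` with the Euclidean norm. -/
def stack {H : Type*} [NormedAddCommGroup H] [InnerProductSpace ℝ H] {d : ℕ}
    (L : Fin d → H →L[ℝ] ℝ) :
    H →L[ℝ] EuclideanSpace ℝ (Fin d) :=
  (EuclideanSpace.equiv (Fin d) ℝ).symm.toContinuousLinearMap ∘L ContinuousLinearMap.pi L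

section Conditioning

variable {H : Type*} [NormedAddCommGroup H] [InnerProductSpace ℝ H] [CompleteSpace H] {d : ℕ}

/-- The Gram operator `G = 𝓘 C 𝓘*` on `ℝᵈ`. -/
def gram (C : H →L[ℝ] H) (I : H →L[ℝ] EuclideanSpace ℝ (Fin d)) :
    EuclideanSpace ℝ (Fin d) →L[ℝ] EuclideanSpace ℝ (Fin d) :=
  I ∘L C ∘L I.adjoint

/-- The posterior mean `a + C 𝓘* G⁻¹ (f - 𝓘 a)`. -/
def postMean (a : H) (C : H →L[ℝ] H) (I : H →L[ℝ] EuclideanSpace ℝ (Fin d))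
    (f : EuclideanSpace ℝ (Fin d)) : H :=
  a + C (I.adjoint ((gram C I).inverse (f - I a)))

/-- The posterior covariance `C - C 𝓘* G⁻¹ 𝓘 C`. -/
def postCov (C : H →L[ℝ] H) (I : H →L[ℝ] EuclideanSpace ℝ (Fin d)) : H →L[ℝ] H :=
  C - C ∘L I.adjoint ∘L (gram C I).inverse ∘L I ∘L C

/-- The Hilbert–Schmidt norm `trace(A* A)^{1/2} = (∑ ‖A eᵢ‖²)^{1/2}`, computed in some Hilbert basis
`(eᵢ)`. -/
def hsNorm (A : H →L[ℝ] H) : ℝ :=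
  √(∑' i, ‖A ((exists_hilbertBasis ℝ H).choose_spec.choose i)‖ ^ 2)

/-- `α = ‖𝓘 C‖ + ‖𝓘̂ C‖`. -/
def alphaConst (C : H →L[ℝ] H) (I Ihat : H →L[ℝ] EuclideanSpace ℝ (Fin d)) : ℝ :=
  ‖I ∘L C‖ + ‖Ihat ∘L C‖

/-- `C_{𝓘,1} = ‖C‖ [(‖a‖ + ‖C‖_HS^{1/2}) (‖G⁻¹ 𝓘‖ + ‖Ĝ⁻¹ 𝓘̂‖) + ‖G⁻¹ f‖]`. -/
def constI1 (a : H) (C : H →L[ℝ] H) (I Ihat : H →L[ℝ] EuclideanSpace ℝ (Fin d))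
    (f : EuclideanSpace ℝ (Fin d)) : ℝ :=
  ‖C‖ * ((‖a‖ + √(hsNorm C)) *
      (‖(gram C I).inverse ∘L I‖ + ‖(gram C Ihat).inverse ∘L Ihat‖) + ‖(gram C I).inverse f‖)

/-- `C_{𝓘,2} = α ‖C‖ (‖G⁻¹‖ ‖𝓘̂‖ ‖G⁻¹ f‖ + ‖G⁻¹‖² ‖𝓘‖ ‖𝓘̂‖ (‖a‖ + ‖C‖_HS^{1/2}))`. -/
def constI2 (a : H) (C : H →L[ℝ] H) (I Ihat : H →L[ℝ] EuclideanSpace ℝ (Fin d))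
    (f : EuclideanSpace ℝ (Fin d)) : ℝ :=
  alphaConst C I Ihat * ‖C‖ *
    (‖(gram C I).inverse‖ * ‖Ihat‖ * ‖(gram C I).inverse f‖ +
      ‖(gram C I).inverse‖ ^ 2 * (‖I‖ * ‖Ihat‖ * (‖a‖ + √(hsNorm C))))

/-- `C_f = ‖C‖ ‖G⁻¹ 𝓘̂‖`. -/
def constF (C : H →L[ℝ] H) (I Ihat : H →L[ℝ] EuclideanSpace ℝ (Fin d)) : ℝ :=
  ‖C‖ * ‖(gram C I).inverse ∘L Ihat‖

/-- `C_{𝓘,1} + C_{𝓘,2} + C_f`. -/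
def robustConst (a : H) (C : H →L[ℝ] H) (I Ihat : H →L[ℝ] EuclideanSpace ℝ (Fin d))
    (f : EuclideanSpace ℝ (Fin d)) : ℝ :=
  constI1 a C I Ihat f + constI2 a C I Ihat f + constF C I Ihat

end Conditioning

/-! ### Information used by the two methods

In both methods the unknown lies in a Hilbert space `H` of functions on `P`, given by an injective
continuous map `ev : H → (P → V)`; `ev x p` is the value of `x` at `p`. The argument `W : P → 𝒰` is
either the solution map `U` or its approximation `Û`. -/

section Information

variable {𝒰 P : Type*} [NormedAddCommGroup 𝒰] [NormedSpace ℝ 𝒰]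
  [NormedAddCommGroup P] [NormedSpace ℝ P]
  {H : Type*} [NormedAddCommGroup H] [InnerProductSpace ℝ H]

/-- The forward information functional `x ↦ T (∂F/∂u [W(p), p] ∘ x(p))`. -/
def fwdFunctional {ℱ : Type*} [NormedAddCommGroup ℱ] [NormedSpace ℝ ℱ]
    (F : 𝒰 → P → ℱ) (ev : H →L[ℝ] (P → (P →L[ℝ] 𝒰))) (W : P → 𝒰)
    (T : (P →L[ℝ] ℱ) →L[ℝ] ℝ) (p : P) : H →L[ℝ] ℝ :=
  T ∘L ContinuousLinearMap.compL ℝ P 𝒰 ℱ (partialU F (W p) p) ∘L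
    ContinuousLinearMap.proj p ∘L ev

/-- The forward information operator `x ↦ (T_j (∂F/∂u [W(p_j), p_j] ∘ x(p_j)))_j`. -/
def fwdInfo {ℱ : Type*} [NormedAddCommGroup ℱ] [NormedSpace ℝ ℱ] {d : ℕ}
    (F : 𝒰 → P → ℱ) (ev : H →L[ℝ] (P → (P →L[ℝ] 𝒰))) (W : P → 𝒰)
    (T : Fin d → (P →L[ℝ] ℱ) →L[ℝ] ℝ) (p : Fin d → P) : H →L[ℝ] EuclideanSpace ℝ (Fin d) :=
  stack fun j => fwdFunctional F ev W (T j) (p j)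

/-- The forward information `f_j = - T_j (∂F/∂p [W(p_j), p_j])`. -/
def fwdData {ℱ : Type*} [NormedAddCommGroup ℱ] [NormedSpace ℝ ℱ] {d : ℕ}
    (F : 𝒰 → P → ℱ) (W : P → 𝒰) (T : Fin d → (P →L[ℝ] ℱ) →L[ℝ] ℝ) (p : Fin d → P) :
    EuclideanSpace ℝ (Fin d) :=
  WithLp.toLp 2 fun j => -T j (partialP F (W (p j)) (p j))

/-- The adjoint information functional `β ↦ ⟪∂F/∂u [W(p), p] e, β(p)⟫`. -/
def adjFunctional {ℱ : Type*} [NormedAddCommGroup ℱ] [InnerProductSpace ℝ ℱ]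
    (F : 𝒰 → P → ℱ) (ev : H →L[ℝ] (P → ℱ)) (W : P → 𝒰) (e : 𝒰) (p : P) : H →L[ℝ] ℝ :=
  innerSL ℝ (partialU F (W p) p e) ∘L ContinuousLinearMap.proj p ∘L ev

/-- The adjoint information operator `β ↦ (⟪∂F/∂u [W(p_j), p_j] e_j, β(p_j)⟫)_j`. -/
def adjInfo {ℱ : Type*} [NormedAddCommGroup ℱ] [InnerProductSpace ℝ ℱ] {d : ℕ}
    (F : 𝒰 → P → ℱ) (ev : H →L[ℝ] (P → ℱ)) (W : P → 𝒰) (e : Fin d → 𝒰) (p : Fin d → P) :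
    H →L[ℝ] EuclideanSpace ℝ (Fin d) :=
  stack fun j => adjFunctional F ev W (e j) (p j)

/-- The adjoint information `f_j = ∂g/∂u [W(p_j), p_j] e_j`. -/
def adjData {d : ℕ} (g : 𝒰 → P → ℝ) (W : P → 𝒰) (e : Fin d → 𝒰) (p : Fin d → P) :
    EuclideanSpace ℝ (Fin d) :=
  WithLp.toLp 2 fun j => partialU g (W (p j)) (p j) (e j)

end Information

end ProbSens

end

noncomputable section

namespace ProbSens

/-! Sample-wise conditioning: if `x` follows the prior, then `x + C 𝓘* G⁻¹ (f - 𝓘 x)` follows the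
posterior (`IsNormal.map_postMap`). Feeding one prior sample through the exact and the perturbed
affine map couples the two posteriors, so `W2` is at most the root mean square distance of the maps
(`W2_map_le`).

Put `Δ = 𝓘 - 𝓘̂` and `B = 𝓘* G⁻¹ 𝓘`, with `B̂` its perturbed version. The maps differ by `C q - C (B
- B̂) (x - a)` with `q` deterministic. Telescoping products, and using `Ĝ - G = -(𝓘̂ C Δ* + Δ C
𝓘*)`, writes `B - B̂` as a sum of terms with exactly one factor `Δ` (`infoOp_sub_apply`). In the
deterministic part `Δ` enters through its operator norm. In the random part it enters through its
Hilbert–Schmidt norm, because a centred functional `⟪y, x - a⟫` has variance `⟪y, C y⟫ ≤ ‖C‖ ‖y‖²`.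
This costs only a factor `√‖C‖`, and `‖C‖ ≤ ‖C‖_HS`. Each row of `Δ` and each data error is at most
`M ε`, so both sizes are at most `η = M ε √d`.

The resulting bound contains some factors `Ĝ⁻¹` where the constants of the theorem have `G⁻¹`. Since
`‖Ĝ⁻¹ - G⁻¹‖ = O(η)`, the exchange costs `O(ε²)`. For small `ε` the whole bound is at most 1, so it
also dominates the square of the distance. -/

/-- The Wasserstein distance of two images of `μ` is at most the root mean square distance of the
two maps. -/
theorem W2_map_le {Ω V : Type*} [MeasurableSpace Ω] [NormedAddCommGroup V] [MeasurableSpace V]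
    [BorelSpace V] [SecondCountableTopology V] (μ : Measure Ω) {S T : Ω → V} (hS : Measurable S)
    (hT : Measurable T) :
    W2 (μ.map S) (μ.map T) ≤ eLpNorm (fun x => S x - T x) 2 μ := by
  rw [W2, eLpNorm_eq_lintegral_rpow_enorm_toReal (by norm_num) (by norm_num)]
  simp only [ENNReal.toReal_ofNat]
  gcongr
  refine (iInf₂_le (μ.map fun x => (S x, T x)) (show _ ∧ _ from ⟨?_, ?_⟩)).trans ?_
  · rw [Measure.map_map measurable_fst (hS.prodMk hT)]; rfl
  · rw [Measure.map_map measurable_snd (hS.prodMk hT)]; rfl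
  · rw [lintegral_map (by fun_prop) (hS.prodMk hT)]
    simp

theorem inner_self_apply_le {H : Type*} [NormedAddCommGroup H] [InnerProductSpace ℝ H]
    (C : H →L[ℝ] H) (x : H) : ⟪x, C x⟫ ≤ ‖C‖ * ‖x‖ ^ 2 := by
  calc ⟪x, C x⟫ ≤ ‖x‖ * ‖C x‖ := real_inner_le_norm _ _
    _ ≤ ‖x‖ * (‖C‖ * ‖x‖) := by gcongr; exact C.le_opNorm x
    _ = ‖C‖ * ‖x‖ ^ 2 := by ring

/-! ### Second moments of Gaussian measures and the size of the covariance. -/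

section Normal

variable {H : Type*} [NormedAddCommGroup H] [InnerProductSpace ℝ H] [CompleteSpace H]
  [MeasurableSpace H] [BorelSpace H]
  {μ : Measure H} {a : H} {C : H →L[ℝ] H}

theorem IsNormal.inner_symm (hμ : IsNormal μ a C) (x y : H) : ⟪C x, y⟫ = ⟪x, C y⟫ := by
  rw [← hμ.cov, covarianceBilin_comm, hμ.cov, real_inner_comm]

theorem IsNormal.adjoint_eq (hμ : IsNormal μ a C) : C.adjoint = C :=
  ((ContinuousLinearMap.eq_adjoint_iff C C).2 hμ.inner_symm).symm

theorem IsNormal.inner_nonneg (hμ : IsNormal μ a C) (x : H) : 0 ≤ ⟪x, C x⟫ := by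
  rw [← hμ.cov]; exact covarianceBilin_self_nonneg x

/-- Cauchy–Schwarz for the semi-inner product `⟪·, C ·⟫`, applied to `x` and `C x`, gives `‖C x‖⁴ ≤
⟪x, C x⟫ ‖C‖ ‖C x‖²`; then cancel. -/
theorem IsNormal.norm_apply_sq_le (hμ : IsNormal μ a C) (x : H) :
    ‖C x‖ ^ 2 ≤ ‖C‖ * ⟪x, C x⟫ := by
  have h := (covarianceBilin μ).toBilinForm.apply_mul_apply_le_of_forall_zero_le
    covarianceBilin_self_nonneg x (C x)
  simp only [ContinuousLinearMap.toBilinForm_apply, hμ.cov, ← hμ.inner_symm x (C x)] at h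
  rw [real_inner_self_eq_norm_sq] at h
  rcases eq_or_ne (C x) 0 with h0 | h0
  · simp [h0]
  · have hpos : 0 < ‖C x‖ ^ 2 := by positivity
    refine le_of_mul_le_mul_right (h.trans ?_) hpos
    calc ⟪x, C x⟫ * ⟪C x, C (C x)⟫ ≤ ⟪x, C x⟫ * (‖C‖ * ‖C x‖ ^ 2) :=
          mul_le_mul_of_nonneg_left (inner_self_apply_le C (C x)) (hμ.inner_nonneg x)
      _ = ‖C‖ * ⟪x, C x⟫ * ‖C x‖ ^ 2 := by ring

variable [SecondCountableTopology H]

theorem IsNormal.memLp_sub_mean (hμ : IsNormal μ a C) : MemLp (fun x => x - a) 2 μ := by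
  have := hμ.gaussian
  exact (IsGaussian.memLp_two_id (μ := μ)).sub (memLp_const a)

theorem IsNormal.integrable_inner_sq (hμ : IsNormal μ a C) (y : H) :
    Integrable (fun x => ⟪y, x - a⟫ ^ 2) μ :=
  (hμ.memLp_sub_mean.const_inner (𝕜 := ℝ) y).integrable_sq

theorem IsNormal.integral_inner_sq (hμ : IsNormal μ a C) (y : H) :
    ∫ x, ⟪y, x - a⟫ ^ 2 ∂μ = ⟪y, C y⟫ := by
  have := hμ.gaussian
  rw [← hμ.cov, covarianceBilin_apply IsGaussian.memLp_two_id]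
  simp only [id, hμ.mean, sq]

/-- The image of a Gaussian measure under an affine map is Gaussian. -/
theorem IsNormal.map_affine (hμ : IsNormal μ a C) (L : H →L[ℝ] H) (c : H) :
    IsNormal (μ.map fun x => c + L x) (c + L a) (L ∘L C ∘L L.adjoint) := by
  have := hμ.gaussian
  have hmap : (μ.map fun x => c + L x) = (μ.map L).map fun x => c + x := by
    rw [Measure.map_map (by fun_prop) (by fun_prop)]; rfl
  refine ⟨by rw [hmap]; infer_instance, ?_, fun x y => ?_⟩
  · have hint : Integrable (fun x : H => x) μ :=
      (IsGaussian.memLp_id μ 1 (by simp)).integrable le_rfl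
    rw [integral_map (by fun_prop) (by fun_prop), integral_add (integrable_const c)
      (L.integrable_comp hint), L.integral_comp_comm hint, hμ.mean]
    simp
  · rw [hmap, covarianceBilin_map_const_add, covarianceBilin_map IsGaussian.memLp_two_id, hμ.cov]
    simp [ContinuousLinearMap.adjoint_inner_left]

/-- If `‖W‖²` is a finite sum of squared centred linear functionals, its root mean square is
controlled by the norms of these functionals. -/
theorem IsNormal.eLpNorm_le_of_sum_inner_sq (hμ : IsNormal μ a C) {K ι : Type*}
    [NormedAddCommGroup K] [Fintype ι] {W : H → K} (y : ι → H)
    (hW : ∀ x, ‖W x‖ ^ 2 = ∑ i, ⟪y i, x - a⟫ ^ 2) {c : ℝ} (hc : 0 ≤ c)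
    (hy : ∑ i, ‖y i‖ ^ 2 ≤ c ^ 2) :
    eLpNorm W 2 μ ≤ ENNReal.ofReal (√‖C‖ * c) := by
  have h : ∫⁻ x, ‖W x‖ₑ ^ (2 : ℝ) ∂μ ≤ ENNReal.ofReal ((√‖C‖ * c) ^ 2) := by
    have h1 : ∀ x, ‖W x‖ₑ ^ (2 : ℝ) = ENNReal.ofReal (∑ i, ⟪y i, x - a⟫ ^ 2) := fun x => by
      rw [← hW, ← ofReal_norm, ENNReal.ofReal_rpow_of_nonneg (norm_nonneg _) (by norm_num)]
      norm_num
    simp_rw [h1]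
    rw [← ofReal_integral_eq_lintegral_ofReal
      (integrable_finsetSum _ fun i _ => hμ.integrable_inner_sq (y i))
      (.of_forall fun x => Finset.sum_nonneg fun i _ => sq_nonneg _),
      integral_finsetSum _ fun i _ => hμ.integrable_inner_sq (y i)]
    refine ENNReal.ofReal_le_ofReal ?_
    calc ∑ i, ∫ x, ⟪y i, x - a⟫ ^ 2 ∂μ = ∑ i, ⟪y i, C (y i)⟫ := by
          simp_rw [hμ.integral_inner_sq]
      _ ≤ ∑ i, ‖C‖ * ‖y i‖ ^ 2 := Finset.sum_le_sum fun i _ => inner_self_apply_le C (y i)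
      _ ≤ ‖C‖ * c ^ 2 := by rw [← Finset.mul_sum]; gcongr
      _ = (√‖C‖ * c) ^ 2 := by rw [mul_pow, Real.sq_sqrt (norm_nonneg _)]
  rw [eLpNorm_eq_lintegral_rpow_enorm_toReal (by norm_num) (by norm_num)]
  simp only [ENNReal.toReal_ofNat]
  calc _ ≤ (ENNReal.ofReal ((√‖C‖ * c) ^ 2)) ^ (1 / 2 : ℝ) := by gcongr
    _ = ENNReal.ofReal (√‖C‖ * c) := by
      rw [ENNReal.ofReal_rpow_of_nonneg (by positivity) (by norm_num), ← Real.sqrt_eq_rpow,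
        Real.sqrt_sq (by positivity)]

/-- The Hilbert–Schmidt norm of a Gaussian covariance dominates its operator norm. -/
theorem IsNormal.norm_le_hsNorm (hμ : IsNormal μ a C) : ‖C‖ ≤ hsNorm C := by
  set b := (exists_hilbertBasis ℝ H).choose_spec.choose with hb
  have hon := b.orthonormal
  -- Without summability the `tsum` in `hsNorm` would be 0. It holds because the covariance has
  -- finite trace: by Bessel, partial sums of `⟪b i, C (b i)⟫` are at most the total variance.
  have hsum : Summable fun i => ‖C (b i)‖ ^ 2 := by
    refine summable_of_sum_le (c := ‖C‖ * ∫ x, ‖x - a‖ ^ 2 ∂μ) (fun i => sq_nonneg _) fun s => ?_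
    calc ∑ i ∈ s, ‖C (b i)‖ ^ 2 ≤ ∑ i ∈ s, ‖C‖ * ⟪b i, C (b i)⟫ :=
          Finset.sum_le_sum fun i _ => hμ.norm_apply_sq_le _
      _ = ‖C‖ * ∫ x, ∑ i ∈ s, ⟪b i, x - a⟫ ^ 2 ∂μ := by
          rw [← Finset.mul_sum, integral_finsetSum _ fun i _ => hμ.integrable_inner_sq _]
          simp_rw [hμ.integral_inner_sq]
      _ ≤ ‖C‖ * ∫ x, ‖x - a‖ ^ 2 ∂μ := by
          refine mul_le_mul_of_nonneg_left ?_ (norm_nonneg _)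
          refine integral_mono (integrable_finsetSum _ fun i _ => hμ.integrable_inner_sq _)
            hμ.memLp_sub_mean.norm.integrable_sq fun x => ?_
          simpa using hon.sum_inner_products_le (x - a) (s := s)
  refine C.opNorm_le_bound (Real.sqrt_nonneg _) fun x => ?_
  rw [hsNorm, ← Real.sqrt_sq (norm_nonneg x), ← Real.sqrt_mul (tsum_nonneg fun i => sq_nonneg _)]
  refine Real.le_sqrt_of_sq_le ?_
  -- Parseval for `C x`; by symmetry each coefficient is `⟪C (b i), x⟫`, to which Cauchy–Schwarz
  -- applies.
  have h2 := b.hasSum_inner_mul_inner (C x) (C x)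
  rw [real_inner_self_eq_norm_sq] at h2
  rw [← h2.tsum_eq, ← tsum_mul_right]
  refine h2.summable.tsum_le_tsum (fun i => ?_) (hsum.mul_right _)
  rw [real_inner_comm, ← sq, ← hμ.inner_symm, real_inner_comm, ← mul_pow, real_inner_comm]
  exact sq_le_sq' (by linarith [neg_abs_le ⟪C (b i), x⟫, abs_real_inner_le_norm (C (b i)) x])
    (real_inner_le_norm _ _)

end Normal

/-! ### Hilbert–Schmidt size of operators into `ℝᵈ` and root mean squares. -/

section Rows

variable {H : Type*} [NormedAddCommGroup H] [InnerProductSpace ℝ H] [CompleteSpace H] {d : ℕ}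

/-- The squared Hilbert–Schmidt norm of an operator into `ℝᵈ`. -/
def rowSq (D : H →L[ℝ] EuclideanSpace ℝ (Fin d)) : ℝ :=
  ∑ j, ‖D.adjoint (EuclideanSpace.basisFun (Fin d) ℝ j)‖ ^ 2

theorem norm_sq_apply_eq (D : H →L[ℝ] EuclideanSpace ℝ (Fin d)) (x : H) :
    ‖D x‖ ^ 2 = ∑ j, ⟪D.adjoint (EuclideanSpace.basisFun (Fin d) ℝ j), x⟫ ^ 2 := by
  rw [← (EuclideanSpace.basisFun (Fin d) ℝ).sum_sq_norm_inner_right (D x)]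
  simp_rw [ContinuousLinearMap.adjoint_inner_left, Real.norm_eq_abs, sq_abs]

theorem norm_le_of_rowSq_le {D : H →L[ℝ] EuclideanSpace ℝ (Fin d)} {η : ℝ} (hη : 0 ≤ η)
    (hD : rowSq D ≤ η ^ 2) : ‖D‖ ≤ η := by
  refine D.opNorm_le_bound hη fun x => ?_
  refine le_of_sq_le_sq ?_ (by positivity)
  rw [norm_sq_apply_eq, mul_pow]
  refine le_trans ?_ (mul_le_mul_of_nonneg_right hD (sq_nonneg _))
  rw [rowSq, Finset.sum_mul]
  refine Finset.sum_le_sum fun j _ => ?_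
  rw [← mul_pow]
  exact sq_le_sq.2 ((abs_real_inner_le_norm _ _).trans (le_abs_self _))

/-- Testing `D` on its own Riesz row `y` gives `‖y‖² ≤ c ‖y‖`. The sign of `c` is asked for only
when `d > 0`, since `M` may be negative when there are no observations. -/
theorem rowSq_le_of_forall_abs_le {D : H →L[ℝ] EuclideanSpace ℝ (Fin d)} {c : ℝ}
    (hD : ∀ j x, |D x j| ≤ c * ‖x‖) (hc : 0 < d → 0 ≤ c) : rowSq D ≤ (c * √d) ^ 2 := by
  rw [mul_pow, Real.sq_sqrt (Nat.cast_nonneg _)]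
  calc rowSq D ≤ ∑ _j : Fin d, c ^ 2 := Finset.sum_le_sum fun j _ => by
        set y := D.adjoint (EuclideanSpace.basisFun (Fin d) ℝ j)
        have h : ‖y‖ * ‖y‖ ≤ c * ‖y‖ := by
          rw [← real_inner_self_eq_norm_mul_norm, ContinuousLinearMap.adjoint_inner_left]
          refine le_trans (le_of_eq ?_) ((le_abs_self _).trans (hD j y))
          simp [EuclideanSpace.inner_single_left]
        have h0 := hc j.pos
        have : ‖y‖ ≤ c := by
          by_contra! hlt
          nlinarith [norm_nonneg y]
        gcongr
    _ = c ^ 2 * d := by simp [mul_comm]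

variable [MeasurableSpace H] [BorelSpace H] [SecondCountableTopology H]
  {μ : Measure H} {a : H} {C : H →L[ℝ] H}

theorem eLpNorm_clm_comp_le {Ω K K' : Type*} [MeasurableSpace Ω] [NormedAddCommGroup K]
    [NormedSpace ℝ K] [NormedAddCommGroup K'] [NormedSpace ℝ K'] (ν : Measure Ω)
    (P : K →L[ℝ] K') {W : Ω → K} {c : ℝ} (hW : eLpNorm W 2 ν ≤ ENNReal.ofReal c) :
    eLpNorm (fun x => P (W x)) 2 ν ≤ ENNReal.ofReal (‖P‖ * c) := by
  refine (eLpNorm_le_mul_eLpNorm_of_ae_le_mul (.of_forall fun x => P.le_opNorm (W x)) 2).trans ?_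
  rw [ENNReal.ofReal_mul (norm_nonneg _)]
  gcongr

/-- The coordinates of `D (S (x - a))` are centred functionals with Riesz vectors `S* D* e_j`. -/
theorem IsNormal.eLpNorm_row_le (hμ : IsNormal μ a C) {D : H →L[ℝ] EuclideanSpace ℝ (Fin d)}
    {η : ℝ} (hη : 0 ≤ η) (hD : rowSq D ≤ η ^ 2) (S : H →L[ℝ] H) :
    eLpNorm (fun x => D (S (x - a))) 2 μ ≤ ENNReal.ofReal (√‖C‖ * (‖S‖ * η)) := by
  refine hμ.eLpNorm_le_of_sum_inner_sq
    (fun j => S.adjoint (D.adjoint (EuclideanSpace.basisFun (Fin d) ℝ j))) (fun x => ?_)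
    (by positivity) ?_
  · simp_rw [norm_sq_apply_eq, ContinuousLinearMap.adjoint_inner_left]
  · rw [mul_pow]
    refine le_trans ?_ (mul_le_mul_of_nonneg_left hD (sq_nonneg _))
    rw [rowSq, Finset.mul_sum]
    refine Finset.sum_le_sum fun j _ => ?_
    rw [← mul_pow, ← ContinuousLinearMap.adjoint.norm_map S]
    gcongr
    exact S.adjoint.le_opNorm _

/-- The vector `D* S (x - a)` stays in the finite-dimensional range of `D*`. In an orthonormal basis
`b` of that range its coordinates are functionals with Riesz vectors `S* D b_i`, and Bessel bounds
`∑ ‖D b_i‖²` by `rowSq D`. -/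
theorem IsNormal.eLpNorm_adjoint_row_le (hμ : IsNormal μ a C)
    {D : H →L[ℝ] EuclideanSpace ℝ (Fin d)}
    {η : ℝ} (hη : 0 ≤ η) (hD : rowSq D ≤ η ^ 2) (S : H →L[ℝ] EuclideanSpace ℝ (Fin d)) :
    eLpNorm (fun x => D.adjoint (S (x - a))) 2 μ ≤ ENNReal.ofReal (√‖C‖ * (‖S‖ * η)) := by
  let V := LinearMap.range (D.adjoint : EuclideanSpace ℝ (Fin d) →ₗ[ℝ] H)
  let b := stdOrthonormalBasis ℝ V
  have hon : Orthonormal ℝ fun i => (b i : H) := b.orthonormal.comp_linearIsometry V.subtypeₗᵢ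
  refine hμ.eLpNorm_le_of_sum_inner_sq (fun i => S.adjoint (D (b i))) (fun x => ?_)
    (by positivity) ?_
  · have h := b.sum_sq_norm_inner_right ⟨D.adjoint (S (x - a)), LinearMap.mem_range_self _ _⟩
    simp only [Submodule.coe_inner, Submodule.coe_norm, Real.norm_eq_abs, sq_abs] at h
    rw [← h]
    simp_rw [ContinuousLinearMap.adjoint_inner_left, ContinuousLinearMap.adjoint_inner_right]
  · calc ∑ i, ‖S.adjoint (D (b i))‖ ^ 2 ≤ ∑ i, ‖S‖ ^ 2 * ‖D (b i)‖ ^ 2 := by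
          refine Finset.sum_le_sum fun i _ => ?_
          rw [← mul_pow, ← ContinuousLinearMap.adjoint.norm_map S]
          gcongr
          exact S.adjoint.le_opNorm _
      _ = ‖S‖ ^ 2 * ∑ j, ∑ i, ⟪(b i : H), D.adjoint (EuclideanSpace.basisFun (Fin d) ℝ j)⟫ ^ 2 := by
          rw [← Finset.mul_sum, Finset.sum_comm]
          simp_rw [norm_sq_apply_eq]
          simp only [fun i => real_inner_comm (b i : H)]
      _ ≤ ‖S‖ ^ 2 * rowSq D := by
          rw [rowSq]
          refine mul_le_mul_of_nonneg_left (Finset.sum_le_sum fun j _ => ?_) (sq_nonneg _)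
          simpa only [Real.norm_eq_abs, sq_abs] using hon.sum_inner_products_le
            (D.adjoint (EuclideanSpace.basisFun (Fin d) ℝ j)) (s := Finset.univ)
      _ ≤ (‖S‖ * η) ^ 2 := by rw [mul_pow]; gcongr

end Rows

/-! ### The Gram operator, its perturbation, and the posterior as an affine image. -/

section Gram

variable {H : Type*} [NormedAddCommGroup H] [InnerProductSpace ℝ H] [CompleteSpace H] {d : ℕ}
  {C : H →L[ℝ] H} {I Ihat : H →L[ℝ] EuclideanSpace ℝ (Fin d)}

theorem isInvertible_of_injective {E : Type*} [NormedAddCommGroup E] [NormedSpace ℝ E]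
    [FiniteDimensional ℝ E] {G : E →L[ℝ] E} (hG : Function.Injective G) : G.IsInvertible :=
  ⟨(LinearEquiv.ofInjectiveEndo (G : E →ₗ[ℝ] E) hG).toContinuousLinearEquiv, by ext; rfl⟩

/-- If `G w = 0` then `⟪𝓘* w, C 𝓘* w⟫ = 0`, which positivity allows only for `𝓘* w = 0`. -/
theorem gram_isInvertible (hpos : ∀ x, x ≠ 0 → 0 < ⟪x, C x⟫)
    (hI : Function.Injective I.adjoint) : (gram C I).IsInvertible := by
  refine isInvertible_of_injective ((injective_iff_map_eq_zero _).2 fun w hw => ?_)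
  by_contra hne
  have h := hpos (I.adjoint w) fun h0 => hne (hI (by simpa using h0))
  rw [ContinuousLinearMap.adjoint_inner_left] at h
  have : I (C (I.adjoint w)) = 0 := hw
  simp [this] at h

theorem stack_adjoint_injective {L : Fin d → H →L[ℝ] ℝ} (hL : LinearIndependent ℝ L) :
    Function.Injective (stack L).adjoint := by
  refine (injective_iff_map_eq_zero _).2 fun w hw => ?_
  have h : ∑ j, w j • L j = 0 := by
    ext x
    have := ContinuousLinearMap.adjoint_inner_left (stack L) x w
    rw [hw, inner_zero_left, PiLp.inner_apply] at this
    simpa [stack, mul_comm] using this.symm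
  ext j
  exact Fintype.linearIndependent_iff.1 hL w h j

theorem gram_adjoint (hC : C.adjoint = C) : (gram C I).adjoint = gram C I := by
  simp [gram, ContinuousLinearMap.adjoint_comp, hC, ContinuousLinearMap.comp_assoc]

theorem inverse_adjoint {E : Type*} [NormedAddCommGroup E] [InnerProductSpace ℝ E]
    [CompleteSpace E] {G : E →L[ℝ] E} (hG : G.IsInvertible) (hsymm : G.adjoint = G) :
    G.inverse.adjoint = G.inverse := by
  refine ((ContinuousLinearMap.eq_adjoint_iff _ _).2 fun x y => ?_).symm
  conv_lhs => rw [← hG.self_apply_inverse y]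
  conv_rhs => rw [← hG.self_apply_inverse x]
  rw [← ContinuousLinearMap.adjoint_inner_left, hsymm]

/-- The perturbation is absorbed into the lower bound `‖w‖ ≤ 2 ‖G⁻¹‖ ‖G' w‖`. In finite dimension
this yields invertibility and the norm of the inverse at once. -/
theorem isInvertible_of_near {E : Type*} [NormedAddCommGroup E] [NormedSpace ℝ E]
    [FiniteDimensional ℝ E] {G G' : E →L[ℝ] E} (hG : G.IsInvertible)
    (h : ‖G.inverse‖ * ‖G' - G‖ ≤ 1 / 2) :
    G'.IsInvertible ∧ ‖G'.inverse‖ ≤ 2 * ‖G.inverse‖ := by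
  have key : ∀ w, ‖w‖ ≤ 2 * ‖G.inverse‖ * ‖G' w‖ := fun w => by
    have h1 : ‖w‖ ≤ ‖G.inverse‖ * (‖G' w‖ + ‖G' - G‖ * ‖w‖) := by
      calc ‖w‖ = ‖G.inverse (G w)‖ := by rw [hG.inverse_apply_self]
        _ ≤ ‖G.inverse‖ * ‖G w‖ := G.inverse.le_opNorm _
        _ ≤ _ := by
          gcongr
          calc ‖G w‖ = ‖G' w - (G' - G) w‖ := by simp
            _ ≤ _ := (norm_sub_le _ _).trans (by gcongr; exact (G' - G).le_opNorm w)
    nlinarith [mul_le_mul_of_nonneg_right h (norm_nonneg w)]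
  have hinv : G'.IsInvertible :=
    isInvertible_of_injective ((injective_iff_map_eq_zero _).2 fun w hw => by
      simpa [hw] using key w)
  refine ⟨hinv, ContinuousLinearMap.opNorm_le_bound _ (by positivity) fun w => ?_⟩
  simpa [hinv.self_apply_inverse] using key (G'.inverse w)

/-- This order keeps `G⁻¹` next to the data, so that `‖G⁻¹ f‖` survives in the estimate. The primed
version below has the opposite order. -/
theorem inverse_sub_inverse_apply {E : Type*} [NormedAddCommGroup E] [NormedSpace ℝ E]
    {G G' : E →L[ℝ] E} (hG : G.IsInvertible) (hG' : G'.IsInvertible) (w : E) :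
    G.inverse w - G'.inverse w = G'.inverse ((G' - G) (G.inverse w)) := by
  simp [hG.self_apply_inverse, hG'.inverse_apply_self]

theorem gram_sub_gram (C : H →L[ℝ] H) (I Ihat : H →L[ℝ] EuclideanSpace ℝ (Fin d)) :
    gram C Ihat - gram C I =
      -(Ihat ∘L C ∘L (I - Ihat).adjoint + (I - Ihat) ∘L C ∘L I.adjoint) := by
  ext w : 1
  simp [gram]

theorem norm_comp_adjoint (hC : C.adjoint = C) (I : H →L[ℝ] EuclideanSpace ℝ (Fin d)) :
    ‖C ∘L I.adjoint‖ = ‖I ∘L C‖ := by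
  rw [← ContinuousLinearMap.adjoint.norm_map (I ∘L C), ContinuousLinearMap.adjoint_comp, hC]

theorem norm_gram_sub_gram_le (hC : C.adjoint = C) {η : ℝ} (h : ‖I - Ihat‖ ≤ η) :
    ‖gram C Ihat - gram C I‖ ≤ alphaConst C I Ihat * η := by
  rw [gram_sub_gram, norm_neg, alphaConst, ← ContinuousLinearMap.comp_assoc]
  calc _ ≤ ‖Ihat ∘L C‖ * ‖(I - Ihat).adjoint‖ + ‖I - Ihat‖ * ‖C ∘L I.adjoint‖ :=
        (norm_add_le _ _).trans (add_le_add (ContinuousLinearMap.opNorm_comp_le _ _)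
          (ContinuousLinearMap.opNorm_comp_le _ _))
    _ ≤ ‖Ihat ∘L C‖ * η + η * ‖I ∘L C‖ := by
        rw [norm_comp_adjoint hC, ContinuousLinearMap.adjoint.norm_map]; gcongr
    _ = _ := by ring

/-- The affine map that turns prior samples into posterior samples. -/
def postMap (C : H →L[ℝ] H) (I : H →L[ℝ] EuclideanSpace ℝ (Fin d))
    (f : EuclideanSpace ℝ (Fin d)) (x : H) : H :=
  C (I.adjoint ((gram C I).inverse f)) +
    (ContinuousLinearMap.id ℝ H - C ∘L I.adjoint ∘L (gram C I).inverse ∘L I) x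

theorem IsNormal.map_postMap [MeasurableSpace H] [BorelSpace H] [SecondCountableTopology H]
    {μ : Measure H} {a : H} (hμ : IsNormal μ a C) (hG : (gram C I).IsInvertible)
    (f : EuclideanSpace ℝ (Fin d)) :
    IsNormal (μ.map (postMap C I f)) (postMean a C I f) (postCov C I) := by
  have hC := hμ.adjoint_eq
  have hmean : postMean a C I f = C (I.adjoint ((gram C I).inverse f)) +
      (ContinuousLinearMap.id ℝ H - C ∘L I.adjoint ∘L (gram C I).inverse ∘L I) a := by
    simp [postMean]; abel
  have hcov : postCov C I =
      (ContinuousLinearMap.id ℝ H - C ∘L I.adjoint ∘L (gram C I).inverse ∘L I) ∘L C ∘L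
        (ContinuousLinearMap.id ℝ H - C ∘L I.adjoint ∘L (gram C I).inverse ∘L I).adjoint := by
    ext x
    -- `𝓘 C 𝓘* G⁻¹ = id` makes the quadratic correction cancel one of the two linear ones.
    have h : ∀ w, I (C (I.adjoint ((gram C I).inverse w))) = w := hG.self_apply_inverse
    simp [postCov, ContinuousLinearMap.adjoint_comp, hC, inverse_adjoint hG (gram_adjoint hC), h,
      ContinuousLinearMap.adjoint_id]
  rw [hmean, hcov]
  exact hμ.map_affine _ _

end Gram

theorem inverse_sub_inverse_apply' {E : Type*} [NormedAddCommGroup E] [NormedSpace ℝ E]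
    {G G' : E →L[ℝ] E} (hG : G.IsInvertible) (hG' : G'.IsInvertible) (w : E) :
    G.inverse w - G'.inverse w = G.inverse ((G' - G) (G'.inverse w)) := by
  simp [hG'.self_apply_inverse, hG.inverse_apply_self]

theorem norm_inverse_sub_inverse_le {E : Type*} [NormedAddCommGroup E] [NormedSpace ℝ E]
    {G G' : E →L[ℝ] E} (hG : G.IsInvertible) (hG' : G'.IsInvertible) :
    ‖G.inverse - G'.inverse‖ ≤ ‖G.inverse‖ * ‖G' - G‖ * ‖G'.inverse‖ := by
  refine ContinuousLinearMap.opNorm_le_bound _ (by positivity) fun w => ?_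
  rw [sub_apply, inverse_sub_inverse_apply' hG hG', mul_assoc, mul_assoc]
  refine (G.inverse.le_opNorm _).trans ?_
  gcongr
  refine ((G' - G).le_opNorm _).trans ?_
  gcongr
  exact G'.inverse.le_opNorm _

theorem eLpNorm_add_sub_sub_le {Ω E : Type*} [MeasurableSpace Ω] [NormedAddCommGroup E]
    {μ : Measure Ω} {u v w z : Ω → E} (hu : AEStronglyMeasurable u μ)
    (hv : AEStronglyMeasurable v μ) (hw : AEStronglyMeasurable w μ)
    (hz : AEStronglyMeasurable z μ) {c₁ c₂ c₃ c₄ : ℝ} (h₁ : 0 ≤ c₁) (h₂ : 0 ≤ c₂) (h₃ : 0 ≤ c₃)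
    (h₄ : 0 ≤ c₄) (hu' : eLpNorm u 2 μ ≤ ENNReal.ofReal c₁)
    (hv' : eLpNorm v 2 μ ≤ ENNReal.ofReal c₂) (hw' : eLpNorm w 2 μ ≤ ENNReal.ofReal c₃)
    (hz' : eLpNorm z 2 μ ≤ ENNReal.ofReal c₄) :
    eLpNorm (fun x => u x + v x - w x - z x) 2 μ ≤ ENNReal.ofReal (c₁ + c₂ + c₃ + c₄) := by
  rw [ENNReal.ofReal_add (by positivity) h₄, ENNReal.ofReal_add (by positivity) h₃,
    ENNReal.ofReal_add h₁ h₂]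
  have one_le : (1 : ℝ≥0∞) ≤ 2 := by norm_num
  exact (eLpNorm_sub_le ((hu.add hv).sub hw) hz one_le).trans
    (add_le_add ((eLpNorm_sub_le (hu.add hv) hw one_le).trans
      (add_le_add ((eLpNorm_add_le hu hv one_le).trans (add_le_add hu' hv')) hw')) hz')

/-! ### First-order comparison of two posteriors. -/

section Perturbation

variable {H : Type*} [NormedAddCommGroup H] [InnerProductSpace ℝ H] [CompleteSpace H] {d : ℕ}
  {C : H →L[ℝ] H} {I Ihat : H →L[ℝ] EuclideanSpace ℝ (Fin d)}

/-- The operator `𝓘* G⁻¹ 𝓘`. -/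
def infoOp (C : H →L[ℝ] H) (I : H →L[ℝ] EuclideanSpace ℝ (Fin d)) : H →L[ℝ] H :=
  I.adjoint ∘L (gram C I).inverse ∘L I

/-- The Lipschitz constant of `𝓘 ↦ 𝓘* G⁻¹ 𝓘`. -/
def infoOpConst (C : H →L[ℝ] H) (I Ihat : H →L[ℝ] EuclideanSpace ℝ (Fin d)) : ℝ :=
  ‖(gram C I).inverse ∘L I‖ + ‖(gram C Ihat).inverse ∘L Ihat‖ +
    alphaConst C I Ihat * (‖I‖ * ‖(gram C I).inverse‖ * ‖(gram C Ihat).inverse‖ * ‖Ihat‖)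

omit [CompleteSpace H] in
theorem alphaConst_nonneg : 0 ≤ alphaConst C I Ihat := by unfold alphaConst; positivity

theorem infoOpConst_nonneg : 0 ≤ infoOpConst C I Ihat := by
  have := alphaConst_nonneg (C := C) (I := I) (Ihat := Ihat)
  unfold infoOpConst; positivity

theorem infoOp_sub_apply (hG : (gram C I).IsInvertible) (hG' : (gram C Ihat).IsInvertible) (x : H) :
    infoOp C I x - infoOp C Ihat x =
      (I.adjoint ∘L (gram C I).inverse) ((I - Ihat) x) +
      (I - Ihat).adjoint (((gram C Ihat).inverse ∘L Ihat) x) -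
      (I.adjoint ∘L (gram C I).inverse ∘L Ihat ∘L C)
        ((I - Ihat).adjoint (((gram C Ihat).inverse ∘L Ihat) x)) -
      (I.adjoint ∘L (gram C I).inverse)
        ((I - Ihat) ((C ∘L I.adjoint ∘L (gram C Ihat).inverse ∘L Ihat) x)) := by
  have h := inverse_sub_inverse_apply' hG hG' (Ihat x)
  rw [gram_sub_gram, sub_eq_iff_eq_add] at h
  simp only [infoOp, ContinuousLinearMap.comp_apply, neg_apply,
    add_apply, sub_apply, map_sub, map_add, map_neg] at h ⊢
  rw [h]
  simp only [map_sub, map_add, map_neg]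
  abel

/-- `G⁻¹` is self-adjoint, so the two operators are adjoint to each other. This is how factors such
as `‖G⁻¹ 𝓘‖` and `‖G⁻¹ 𝓘̂‖` arise. -/
theorem norm_adjoint_comp_inverse (hC : C.adjoint = C) (hG : (gram C I).IsInvertible)
    (J : H →L[ℝ] EuclideanSpace ℝ (Fin d)) :
    ‖J.adjoint ∘L (gram C I).inverse‖ = ‖(gram C I).inverse ∘L J‖ := by
  rw [← ContinuousLinearMap.adjoint.norm_map ((gram C I).inverse ∘L J),
    ContinuousLinearMap.adjoint_comp, inverse_adjoint hG (gram_adjoint hC)]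

theorem norm_comp_adjoint_comp_comp_le (hC : C.adjoint = C)
    (R' : EuclideanSpace ℝ (Fin d) →L[ℝ] EuclideanSpace ℝ (Fin d)) :
    ‖C ∘L I.adjoint ∘L R' ∘L Ihat‖ ≤ ‖I ∘L C‖ * (‖R'‖ * ‖Ihat‖) := by
  rw [← norm_comp_adjoint hC, ← ContinuousLinearMap.comp_assoc]
  refine (ContinuousLinearMap.opNorm_comp_le _ _).trans ?_
  gcongr
  exact ContinuousLinearMap.opNorm_comp_le _ _

theorem norm_adjoint_comp_comp_comp_le
    (R : EuclideanSpace ℝ (Fin d) →L[ℝ] EuclideanSpace ℝ (Fin d)) :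
    ‖I.adjoint ∘L R ∘L Ihat ∘L C‖ ≤ ‖I‖ * (‖R‖ * ‖Ihat ∘L C‖) := by
  refine (ContinuousLinearMap.opNorm_comp_le _ _).trans ?_
  rw [ContinuousLinearMap.adjoint.norm_map]
  gcongr
  exact ContinuousLinearMap.opNorm_comp_le _ _

theorem norm_infoOp_sub_le (hC : C.adjoint = C) (hG : (gram C I).IsInvertible)
    (hG' : (gram C Ihat).IsInvertible) {η : ℝ} (h : ‖I - Ihat‖ ≤ η) (x : H) :
    ‖infoOp C I x - infoOp C Ihat x‖ ≤ infoOpConst C I Ihat * η * ‖x‖ := by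
  have hη : 0 ≤ η := (norm_nonneg _).trans h
  have hδ : ∀ y, ‖(I - Ihat) y‖ ≤ η * ‖y‖ := fun y => (I - Ihat).le_of_opNorm_le h y
  have hδ' : ∀ y, ‖(I - Ihat).adjoint y‖ ≤ η * ‖y‖ := fun y =>
    (I - Ihat).adjoint.le_of_opNorm_le (by rwa [ContinuousLinearMap.adjoint.norm_map]) y
  have hRI := norm_adjoint_comp_inverse hC hG I
  have hRIle : ‖I.adjoint ∘L (gram C I).inverse‖ ≤ ‖I‖ * ‖(gram C I).inverse‖ := by
    simpa only [ContinuousLinearMap.adjoint.norm_map] using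
      ContinuousLinearMap.opNorm_comp_le I.adjoint (gram C I).inverse
  have hRIhat := ContinuousLinearMap.opNorm_comp_le (gram C Ihat).inverse Ihat
  have t1 : ‖(I.adjoint ∘L (gram C I).inverse) ((I - Ihat) x)‖ ≤
      ‖(gram C I).inverse ∘L I‖ * (η * ‖x‖) := by
    rw [← hRI]; exact (ContinuousLinearMap.le_opNorm _ _).trans (by gcongr; exact hδ x)
  have t2 : ‖(I - Ihat).adjoint (((gram C Ihat).inverse ∘L Ihat) x)‖ ≤
      η * (‖(gram C Ihat).inverse ∘L Ihat‖ * ‖x‖) :=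
    (hδ' _).trans (by gcongr; exact ContinuousLinearMap.le_opNorm _ _)
  have t3 : ‖(I.adjoint ∘L (gram C I).inverse ∘L Ihat ∘L C)
        ((I - Ihat).adjoint (((gram C Ihat).inverse ∘L Ihat) x))‖ ≤
      ‖I‖ * (‖(gram C I).inverse‖ * ‖Ihat ∘L C‖) *
        (η * (‖(gram C Ihat).inverse‖ * ‖Ihat‖ * ‖x‖)) := by
    refine (ContinuousLinearMap.le_of_opNorm_le _ (norm_adjoint_comp_comp_comp_le _) _).trans ?_
    gcongr
    exact t2.trans (by gcongr)
  have t4 : ‖(I.adjoint ∘L (gram C I).inverse)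
        ((I - Ihat) ((C ∘L I.adjoint ∘L (gram C Ihat).inverse ∘L Ihat) x))‖ ≤
      ‖I‖ * ‖(gram C I).inverse‖ *
        (η * (‖I ∘L C‖ * (‖(gram C Ihat).inverse‖ * ‖Ihat‖) * ‖x‖)) := by
    refine (ContinuousLinearMap.le_of_opNorm_le _ hRIle _).trans ?_
    gcongr
    refine (hδ _).trans ?_
    gcongr
    exact ContinuousLinearMap.le_of_opNorm_le _ (norm_comp_adjoint_comp_comp_le hC _) _
  rw [infoOp_sub_apply hG hG']
  refine (norm_sub_le_of_le (norm_sub_le_of_le (norm_add_le_of_le t1 t2) t3) t4).trans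
    (le_of_eq ?_)
  unfold infoOpConst alphaConst
  ring

/-- Telescoping leaves the data error under `𝓘̂* Ĝ⁻¹`. Replacing this by `𝓘̂* G⁻¹` produces the
factor of `C_f`; the correction is a product of two small quantities. -/
theorem norm_adjoint_data_sub_le (hC : C.adjoint = C) (hG : (gram C I).IsInvertible)
    (hG' : (gram C Ihat).IsInvertible) {η : ℝ} (h : ‖I - Ihat‖ ≤ η)
    {f fhat : EuclideanSpace ℝ (Fin d)} (hf : ‖f - fhat‖ ≤ η) :
    ‖I.adjoint ((gram C I).inverse f) - Ihat.adjoint ((gram C Ihat).inverse fhat)‖ ≤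
      (‖(gram C I).inverse f‖ +
        ‖Ihat‖ * (‖(gram C Ihat).inverse‖ * (alphaConst C I Ihat * ‖(gram C I).inverse f‖)) +
        (‖(gram C I).inverse ∘L Ihat‖ +
          ‖Ihat‖ * ‖(gram C I).inverse - (gram C Ihat).inverse‖)) * η := by
  have hη : 0 ≤ η := (norm_nonneg _).trans h
  have t1 : ‖(I - Ihat).adjoint ((gram C I).inverse f)‖ ≤ η * ‖(gram C I).inverse f‖ :=
    (I - Ihat).adjoint.le_of_opNorm_le (by rwa [ContinuousLinearMap.adjoint.norm_map]) _
  have t2 : ‖Ihat.adjoint ((gram C Ihat).inverse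
      ((gram C Ihat - gram C I) ((gram C I).inverse f)))‖ ≤
      ‖Ihat‖ * (‖(gram C Ihat).inverse‖ * (alphaConst C I Ihat * η * ‖(gram C I).inverse f‖)) := by
    rw [← ContinuousLinearMap.adjoint.norm_map Ihat]
    refine (Ihat.adjoint.le_opNorm _).trans ?_
    gcongr
    refine (ContinuousLinearMap.le_opNorm _ _).trans ?_
    gcongr
    exact ContinuousLinearMap.le_of_opNorm_le _ (norm_gram_sub_gram_le hC h) _
  have t3 : ‖(Ihat.adjoint ∘L (gram C I).inverse) (f - fhat)‖ ≤
      ‖(gram C I).inverse ∘L Ihat‖ * η := by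
    rw [← norm_adjoint_comp_inverse hC hG]
    exact (ContinuousLinearMap.le_opNorm _ _).trans (by gcongr)
  have t4 : ‖Ihat.adjoint (((gram C I).inverse - (gram C Ihat).inverse) (f - fhat))‖ ≤
      ‖Ihat‖ * (‖(gram C I).inverse - (gram C Ihat).inverse‖ * η) := by
    rw [← ContinuousLinearMap.adjoint.norm_map Ihat]
    refine (Ihat.adjoint.le_opNorm _).trans ?_
    gcongr
    exact (ContinuousLinearMap.le_opNorm _ _).trans (by gcongr)
  have hsplit : I.adjoint ((gram C I).inverse f) - Ihat.adjoint ((gram C Ihat).inverse fhat) =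
      (I - Ihat).adjoint ((gram C I).inverse f) + Ihat.adjoint ((gram C Ihat).inverse
        ((gram C Ihat - gram C I) ((gram C I).inverse f))) +
      ((Ihat.adjoint ∘L (gram C I).inverse) (f - fhat) -
        Ihat.adjoint (((gram C I).inverse - (gram C Ihat).inverse) (f - fhat))) := by
    rw [← inverse_sub_inverse_apply hG hG']
    simp only [ContinuousLinearMap.comp_apply, sub_apply, map_sub]
    abel
  rw [hsplit]
  refine (norm_add_le_of_le (norm_add_le_of_le t1 t2) (norm_sub_le_of_le t3 t4)).trans
    (le_of_eq ?_)
  ring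

variable [MeasurableSpace H] [BorelSpace H] [SecondCountableTopology H]
  {μ : Measure H} {a : H}

/-- Mean-square counterpart of `norm_infoOp_sub_le`, from the same four terms. The constant is the
same, so that `‖a‖` and `√‖C‖` combine into one factor. -/
theorem IsNormal.eLpNorm_infoOp_sub_le (hμ : IsNormal μ a C) (hG : (gram C I).IsInvertible)
    (hG' : (gram C Ihat).IsInvertible) {η : ℝ} (hη : 0 ≤ η) (h : rowSq (I - Ihat) ≤ η ^ 2) :
    eLpNorm (fun x => infoOp C I (x - a) - infoOp C Ihat (x - a)) 2 μ ≤
      ENNReal.ofReal (√‖C‖ * (infoOpConst C I Ihat * η)) := by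
  have hC := hμ.adjoint_eq
  have hRI := norm_adjoint_comp_inverse hC hG I
  have hRIle : ‖I.adjoint ∘L (gram C I).inverse‖ ≤ ‖I‖ * ‖(gram C I).inverse‖ := by
    simpa only [ContinuousLinearMap.adjoint.norm_map] using
      ContinuousLinearMap.opNorm_comp_le I.adjoint (gram C I).inverse
  have hRIhat := ContinuousLinearMap.opNorm_comp_le (gram C Ihat).inverse Ihat
  have t1 : eLpNorm (fun x => (I.adjoint ∘L (gram C I).inverse) ((I - Ihat) (x - a))) 2 μ ≤
      ENNReal.ofReal (‖(gram C I).inverse ∘L I‖ * (√‖C‖ * η)) := by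
    rw [← hRI]
    refine eLpNorm_clm_comp_le μ _
      ((hμ.eLpNorm_row_le hη h (ContinuousLinearMap.id ℝ H)).trans (ENNReal.ofReal_le_ofReal ?_))
    gcongr
    exact mul_le_of_le_one_left hη ContinuousLinearMap.norm_id_le
  have t2 : eLpNorm (fun x => (I - Ihat).adjoint (((gram C Ihat).inverse ∘L Ihat) (x - a))) 2 μ ≤
      ENNReal.ofReal (√‖C‖ * (‖(gram C Ihat).inverse ∘L Ihat‖ * η)) :=
    hμ.eLpNorm_adjoint_row_le hη h _
  have t3 : eLpNorm (fun x => (I.adjoint ∘L (gram C I).inverse ∘L Ihat ∘L C)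
        ((I - Ihat).adjoint (((gram C Ihat).inverse ∘L Ihat) (x - a)))) 2 μ ≤
      ENNReal.ofReal (‖I‖ * (‖(gram C I).inverse‖ * ‖Ihat ∘L C‖) *
        (√‖C‖ * (‖(gram C Ihat).inverse‖ * ‖Ihat‖ * η))) := by
    refine (eLpNorm_clm_comp_le μ _ t2).trans (ENNReal.ofReal_le_ofReal ?_)
    gcongr
    exact norm_adjoint_comp_comp_comp_le _
  have t4 : eLpNorm (fun x => (I.adjoint ∘L (gram C I).inverse)
        ((I - Ihat) ((C ∘L I.adjoint ∘L (gram C Ihat).inverse ∘L Ihat) (x - a)))) 2 μ ≤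
      ENNReal.ofReal (‖I‖ * ‖(gram C I).inverse‖ *
        (√‖C‖ * (‖I ∘L C‖ * (‖(gram C Ihat).inverse‖ * ‖Ihat‖) * η))) := by
    refine (eLpNorm_clm_comp_le μ _ (hμ.eLpNorm_row_le hη h _)).trans (ENNReal.ofReal_le_ofReal ?_)
    gcongr
    exact norm_comp_adjoint_comp_comp_le hC _
  simp_rw [infoOp_sub_apply hG hG']
  have hm : ∀ L : H →L[ℝ] H, AEStronglyMeasurable (fun x => L (x - a)) μ := fun L =>
    (L.continuous.comp (continuous_id.sub continuous_const)).aestronglyMeasurable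
  refine (eLpNorm_add_sub_sub_le
    (hm ((I.adjoint ∘L (gram C I).inverse) ∘L (I - Ihat)))
    (hm ((I - Ihat).adjoint ∘L ((gram C Ihat).inverse ∘L Ihat)))
    (hm ((I.adjoint ∘L (gram C I).inverse ∘L Ihat ∘L C) ∘L
      (I - Ihat).adjoint ∘L ((gram C Ihat).inverse ∘L Ihat)))
    (hm ((I.adjoint ∘L (gram C I).inverse) ∘L (I - Ihat) ∘L
      (C ∘L I.adjoint ∘L (gram C Ihat).inverse ∘L Ihat)))
    (by positivity) (by positivity) (by positivity) (by positivity) t1 t2 t3 t4).trans ?_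
  refine ENNReal.ofReal_le_ofReal (le_of_eq ?_)
  unfold infoOpConst alphaConst
  ring

theorem IsNormal.W2_postMap_le (hμ : IsNormal μ a C) (hG : (gram C I).IsInvertible)
    (hG' : (gram C Ihat).IsInvertible) {η : ℝ} (hη : 0 ≤ η) (h : rowSq (I - Ihat) ≤ η ^ 2)
    {f fhat : EuclideanSpace ℝ (Fin d)} (hf : ‖f - fhat‖ ≤ η) :
    W2 (μ.map (postMap C I f)) (μ.map (postMap C Ihat fhat)) ≤ ENNReal.ofReal
      (‖C‖ * ((‖a‖ + √(hsNorm C)) * infoOpConst C I Ihat +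
        (‖(gram C I).inverse f‖ +
          ‖Ihat‖ * (‖(gram C Ihat).inverse‖ * (alphaConst C I Ihat * ‖(gram C I).inverse f‖)) +
          (‖(gram C I).inverse ∘L Ihat‖ +
            ‖Ihat‖ * ‖(gram C I).inverse - (gram C Ihat).inverse‖))) * η) := by
  have hC := hμ.adjoint_eq
  have := hμ.gaussian
  have hn := norm_le_of_rowSq_le hη h
  have hα := alphaConst_nonneg (C := C) (I := I) (Ihat := Ihat)
  have hβ := infoOpConst_nonneg (C := C) (I := I) (Ihat := Ihat)
  have hm : ∀ (c : H) (L : H →L[ℝ] H), Continuous fun x => c + L x := fun c L =>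
    continuous_const.add L.continuous
  refine (W2_map_le μ (S := postMap C I f) (T := postMap C Ihat fhat)
    (hm _ _).measurable (hm _ _).measurable).trans ?_
  -- The deterministic shift: data part minus the effect of the operator change on the prior mean.
  set q := I.adjoint ((gram C I).inverse f) - Ihat.adjoint ((gram C Ihat).inverse fhat) -
    (infoOp C I a - infoOp C Ihat a) with hq
  have hdiff : ∀ x, postMap C I f x - postMap C Ihat fhat x =
      C q - C (infoOp C I (x - a) - infoOp C Ihat (x - a)) := fun x => by
    simp only [postMap, hq, infoOp, ContinuousLinearMap.comp_apply, sub_apply,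
      ContinuousLinearMap.id_apply, map_sub]
    abel
  simp_rw [hdiff]
  have hqn := norm_sub_le_of_le (norm_adjoint_data_sub_le hC hG hG' hn hf)
    (norm_infoOp_sub_le hC hG hG' hn a)
  have t1 : eLpNorm (fun _ : H => C q) 2 μ ≤ ENNReal.ofReal (‖C‖ * ‖q‖) := by
    rw [eLpNorm_const _ (by norm_num) (NeZero.ne μ)]
    simp only [measure_univ, ENNReal.one_rpow, mul_one, ← ofReal_norm]
    exact ENNReal.ofReal_le_ofReal (C.le_opNorm q)
  have t2 := eLpNorm_clm_comp_le μ C (hμ.eLpNorm_infoOp_sub_le hG hG' hη h)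
  have hm' : Continuous fun x => C (infoOp C I (x - a) - infoOp C Ihat (x - a)) :=
    (C ∘L (infoOp C I - infoOp C Ihat)).continuous.comp (continuous_id.sub continuous_const)
  refine (eLpNorm_sub_le aestronglyMeasurable_const hm'.aestronglyMeasurable (by norm_num)).trans
    ((add_le_add t1 t2).trans ?_)
  rw [← ENNReal.ofReal_add (by positivity) (by positivity)]
  refine ENNReal.ofReal_le_ofReal ?_
  -- The only place where the Hilbert–Schmidt norm of `C` enters the estimate.
  have hs : √‖C‖ ≤ √(hsNorm C) := Real.sqrt_le_sqrt hμ.norm_le_hsNorm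
  refine (add_le_add (mul_le_mul_of_nonneg_left hqn (norm_nonneg C))
    (mul_le_mul_of_nonneg_left (mul_le_mul_of_nonneg_right hs (by positivity))
      (norm_nonneg C))).trans (le_of_eq ?_)
  ring

end Perturbation

/-! ### Uniform constants and the quadratic remainder. -/

section Robustness

variable {H : Type*} [NormedAddCommGroup H] [InnerProductSpace ℝ H] [CompleteSpace H] {d : ℕ}
  {C : H →L[ℝ] H} {I Ihat : H →L[ℝ] EuclideanSpace ℝ (Fin d)}

/-- The coefficient of the quadratic remainder, in terms of bounds `j ≥ ‖𝓘̂‖` and `A ≥ α`. -/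
def remainderConst (a : H) (C : H →L[ℝ] H) (I : H →L[ℝ] EuclideanSpace ℝ (Fin d))
    (f : EuclideanSpace ℝ (Fin d)) (j A : ℝ) : ℝ :=
  ‖C‖ * ((‖a‖ + √(hsNorm C)) * (A * (‖I‖ * ‖(gram C I).inverse‖ * j)) +
    (j * (A * ‖(gram C I).inverse f‖) + j)) * (2 * ‖(gram C I).inverse‖ ^ 2 * A)

/-- A bound for `robustConst` that is uniform in `𝓘̂` with `‖𝓘̂‖ ≤ j`, `α ≤ A`, `‖Ĝ⁻¹‖ ≤ 2 ‖G⁻¹‖`. -/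
def robustBound (a : H) (C : H →L[ℝ] H) (I : H →L[ℝ] EuclideanSpace ℝ (Fin d))
    (f : EuclideanSpace ℝ (Fin d)) (j A : ℝ) : ℝ :=
  ‖C‖ * ((‖a‖ + √(hsNorm C)) *
      (‖(gram C I).inverse ∘L I‖ + 2 * ‖(gram C I).inverse‖ * j) + ‖(gram C I).inverse f‖) +
  A * ‖C‖ * (‖(gram C I).inverse‖ * j * ‖(gram C I).inverse f‖ +
      ‖(gram C I).inverse‖ ^ 2 * (‖I‖ * j * (‖a‖ + √(hsNorm C)))) +
  ‖C‖ * (‖(gram C I).inverse‖ * j)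

theorem robustConst_le (a : H) (f : EuclideanSpace ℝ (Fin d)) {j A : ℝ} (hj : ‖Ihat‖ ≤ j)
    (hA : alphaConst C I Ihat ≤ A)
    (hR : ‖(gram C Ihat).inverse‖ ≤ 2 * ‖(gram C I).inverse‖) :
    robustConst a C I Ihat f ≤ robustBound a C I f j A := by
  have hα := alphaConst_nonneg (C := C) (I := I) (Ihat := Ihat)
  have h1 : ‖(gram C Ihat).inverse ∘L Ihat‖ ≤ 2 * ‖(gram C I).inverse‖ * j :=
    (ContinuousLinearMap.opNorm_comp_le _ _).trans (by gcongr)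
  have h2 : ‖(gram C I).inverse ∘L Ihat‖ ≤ ‖(gram C I).inverse‖ * j :=
    (ContinuousLinearMap.opNorm_comp_le _ _).trans (by gcongr)
  have hA0 : 0 ≤ A := hα.trans hA
  unfold robustConst robustBound constI1 constI2 constF
  gcongr

omit [CompleteSpace H] in
theorem alphaConst_le {j : ℝ} (hj : ‖Ihat‖ ≤ j) : alphaConst C I Ihat ≤ (‖I‖ + j) * ‖C‖ := by
  rw [alphaConst, add_mul]
  exact add_le_add (ContinuousLinearMap.opNorm_comp_le _ _)
    ((ContinuousLinearMap.opNorm_comp_le _ _).trans (by gcongr))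

/-- With `κ = 2 ‖G⁻¹‖² A`, both `‖G⁻¹ - Ĝ⁻¹‖ ≤ κ η` and `‖Ĝ⁻¹‖ ≤ ‖G⁻¹‖ + κ η` hold; everything
carrying `κ` goes into the remainder. -/
theorem perturbation_le_robustConst (hC : C.adjoint = C) (a : H) (f : EuclideanSpace ℝ (Fin d))
    {j A η : ℝ} (hη : 0 ≤ η) (hn : ‖I - Ihat‖ ≤ η) (hG : (gram C I).IsInvertible)
    (hG' : (gram C Ihat).IsInvertible) (hj : ‖Ihat‖ ≤ j) (hA : alphaConst C I Ihat ≤ A)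
    (hR : ‖(gram C Ihat).inverse‖ ≤ 2 * ‖(gram C I).inverse‖) :
    ‖C‖ * ((‖a‖ + √(hsNorm C)) * infoOpConst C I Ihat +
        (‖(gram C I).inverse f‖ +
          ‖Ihat‖ * (‖(gram C Ihat).inverse‖ * (alphaConst C I Ihat * ‖(gram C I).inverse f‖)) +
          (‖(gram C I).inverse ∘L Ihat‖ +
            ‖Ihat‖ * ‖(gram C I).inverse - (gram C Ihat).inverse‖))) * η ≤
      robustConst a C I Ihat f * η + remainderConst a C I f j A * η ^ 2 := by
  have hα := alphaConst_nonneg (C := C) (I := I) (Ihat := Ihat)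
  have hj0 : 0 ≤ j := (norm_nonneg _).trans hj
  have hA0 : 0 ≤ A := hα.trans hA
  have hρ : ‖(gram C I).inverse - (gram C Ihat).inverse‖ ≤
      2 * ‖(gram C I).inverse‖ ^ 2 * A * η := by
    refine (norm_inverse_sub_inverse_le hG hG').trans ?_
    calc _ ≤ ‖(gram C I).inverse‖ * (A * η) * (2 * ‖(gram C I).inverse‖) := by
          gcongr
          exact (norm_gram_sub_gram_le hC hn).trans (by gcongr)
      _ = _ := by ring
  have hR' : ‖(gram C Ihat).inverse‖ ≤ ‖(gram C I).inverse‖ +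
      2 * ‖(gram C I).inverse‖ ^ 2 * A * η := by
    have h := norm_sub_norm_le (gram C Ihat).inverse (gram C I).inverse
    rw [norm_sub_rev] at h
    linarith
  unfold robustConst remainderConst constI1 constI2 constF infoOpConst
  generalize alphaConst C I Ihat = α at *
  generalize ‖(gram C I).inverse ∘L Ihat‖ = u at *
  generalize ‖(gram C Ihat).inverse ∘L Ihat‖ = u' at *
  generalize ‖(gram C I).inverse ∘L I‖ = v at *
  obtain ⟨κ, hκ⟩ : ∃ κ, κ = 2 * ‖(gram C I).inverse‖ ^ 2 * A := ⟨_, rfl⟩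
  have hκ0 : 0 ≤ κ := by rw [hκ]; positivity
  rw [← hκ] at hρ hR' ⊢
  calc _ ≤ ‖C‖ * ((‖a‖ + √(hsNorm C)) * (v + u' +
          α * (‖I‖ * ‖(gram C I).inverse‖ * (‖(gram C I).inverse‖ + κ * η) * ‖Ihat‖)) +
        (‖(gram C I).inverse f‖ +
          ‖Ihat‖ * ((‖(gram C I).inverse‖ + κ * η) * (α * ‖(gram C I).inverse f‖)) +
          (u + ‖Ihat‖ * (κ * η)))) * η := by gcongr
    _ = (‖C‖ * ((‖a‖ + √(hsNorm C)) * (v + u') + ‖(gram C I).inverse f‖) +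
        α * ‖C‖ * (‖(gram C I).inverse‖ * ‖Ihat‖ * ‖(gram C I).inverse f‖ +
          ‖(gram C I).inverse‖ ^ 2 * (‖I‖ * ‖Ihat‖ * (‖a‖ + √(hsNorm C)))) + ‖C‖ * u) * η +
        ‖C‖ * ((‖a‖ + √(hsNorm C)) * (α * (‖I‖ * ‖(gram C I).inverse‖ * ‖Ihat‖)) +
          (‖Ihat‖ * (α * ‖(gram C I).inverse f‖) + ‖Ihat‖)) * κ * η ^ 2 := by ring
    _ ≤ _ := by gcongr

/-- Robustness of the posterior under perturbation of the information. -/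
theorem IsNormal.exists_posterior_robust [MeasurableSpace H] [BorelSpace H]
    [SecondCountableTopology H] {μ : Measure H} {a : H} (hμ : IsNormal μ a C)
    (hG : (gram C I).IsInvertible) (f : EuclideanSpace ℝ (Fin d)) :
    ∃ K η₀ : ℝ, 0 < η₀ ∧ ∀ η, 0 ≤ η → η < η₀ →
      ∀ (Ihat : H →L[ℝ] EuclideanSpace ℝ (Fin d)) (fhat : EuclideanSpace ℝ (Fin d)),
      rowSq (I - Ihat) ≤ η ^ 2 → ‖f - fhat‖ ≤ η →
      (gram C Ihat).IsInvertible ∧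
      W2 (μ.map (postMap C I f)) (μ.map (postMap C Ihat fhat)) ≤
        ENNReal.ofReal (robustConst a C I Ihat f * η + K * η ^ 2) ∧
      robustConst a C I Ihat f * η + K * η ^ 2 ≤ 1 := by
  have hC := hμ.adjoint_eq
  -- Bounds for `‖𝓘̂‖` and `α` valid whenever `η ≤ 1`, hence independent of `𝓘̂`.
  obtain ⟨j, hj⟩ : ∃ j, j = ‖I‖ + 1 := ⟨_, rfl⟩
  obtain ⟨A, hA⟩ : ∃ A, A = (‖I‖ + j) * ‖C‖ := ⟨_, rfl⟩
  have hj0 : 0 ≤ j := by rw [hj]; positivity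
  have hA0 : 0 ≤ A := by rw [hA]; positivity
  have hK : 0 ≤ remainderConst a C I f j A := by unfold remainderConst; positivity
  have hB : 0 ≤ robustBound a C I f j A := by unfold robustBound; positivity
  set K := remainderConst a C I f j A
  set B := robustBound a C I f j A
  set r := ‖(gram C I).inverse‖ with hr
  have hr0 : 0 ≤ r := norm_nonneg _
  have hD : 0 < 2 * (r * A) + B + K + 1 := by positivity
  -- In the denominator, `2 r A` keeps `Ĝ` invertible, `B + K` makes the final bound at most 1, and
  -- the summand 1 forces `η ≤ 1`.
  refine ⟨K, 1 / (2 * (r * A) + B + K + 1), by positivity, fun η hη hlt Ihat fhat hrow hf => ?_⟩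
  have hsmall : η * (2 * (r * A) + B + K + 1) < 1 := (lt_div_iff₀ hD).1 hlt
  have hrA := mul_nonneg hη (mul_nonneg hr0 hA0)
  have hηB := mul_nonneg hη hB
  have hηK := mul_nonneg hη hK
  have hη1 : η ≤ 1 := by nlinarith
  have hn := norm_le_of_rowSq_le hη hrow
  have hIhat : ‖Ihat‖ ≤ j := by
    have h := norm_sub_norm_le Ihat I
    rw [norm_sub_rev] at h
    linarith
  have hα : alphaConst C I Ihat ≤ A := hA ▸ alphaConst_le hIhat
  obtain ⟨hG', hR⟩ := isInvertible_of_near (G' := gram C Ihat) hG (by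
    have h : ‖gram C Ihat - gram C I‖ ≤ A * η :=
      (norm_gram_sub_gram_le hC hn).trans (by gcongr)
    calc _ ≤ r * (A * η) := by gcongr
      _ ≤ 1 / 2 := by nlinarith)
  refine ⟨hG', (hμ.W2_postMap_le hG hG' hη hrow hf).trans (ENNReal.ofReal_le_ofReal
    (perturbation_le_robustConst hC a f hη hn hG hG' hIhat hα hR)), ?_⟩
  have h1 : robustConst a C I Ihat f * η ≤ B * η := by
    gcongr; exact robustConst_le a f hIhat hα hR
  have h2 : K * η ^ 2 ≤ K * η := by
    gcongr; nlinarith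
  nlinarith

end Robustness

theorem euclidean_norm_le_of_forall_abs_le {d : ℕ} {v : EuclideanSpace ℝ (Fin d)} {c : ℝ}
    (hc : 0 < d → 0 ≤ c) (hv : ∀ j, |v j| ≤ c) : ‖v‖ ≤ c * √d := by
  rcases Nat.eq_zero_or_pos d with rfl | hd
  · simp [EuclideanSpace.norm_eq]
  · have hc0 := hc hd
    refine le_of_sq_le_sq ?_ (by positivity)
    rw [EuclideanSpace.real_norm_sq_eq, mul_pow, Real.sq_sqrt (Nat.cast_nonneg _)]
    calc ∑ j, v j ^ 2 ≤ ∑ _j : Fin d, c ^ 2 := Finset.sum_le_sum fun j _ =>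
          sq_le_sq' (abs_le.1 (hv j)).1 (abs_le.1 (hv j)).2
      _ = c ^ 2 * d := by simp [mul_comm]

/-- Conditioning a Gaussian measure on finitely many functionals is stable under perturbations of
the functionals and of the data of size `M ε`. -/
theorem IsNormal.exists_posterior_of_functionals_close {H : Type*} [NormedAddCommGroup H]
    [InnerProductSpace ℝ H] [CompleteSpace H] [SecondCountableTopology H] [MeasurableSpace H]
    [BorelSpace H] {μ : Measure H} {a : H} {C : H →L[ℝ] H} (hμ : IsNormal μ a C)
    (hpos : ∀ x, x ≠ 0 → 0 < ⟪x, C x⟫) {d : ℕ} {L : Fin d → H →L[ℝ] ℝ}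
    (hL : LinearIndependent ℝ L) (f : EuclideanSpace ℝ (Fin d)) {M : ℝ} (hM : 0 < d → 0 ≤ M) :
    ∃ μbar : Measure H, IsNormal μbar (postMean a C (stack L) f) (postCov C (stack L)) ∧
      ∃ K ε₀ : ℝ, 0 < ε₀ ∧ ∀ ε, 0 < ε → ε < ε₀ →
        ∀ (Lhat : Fin d → H →L[ℝ] ℝ) (fhat : EuclideanSpace ℝ (Fin d)),
        (∀ j x, |L j x - Lhat j x| ≤ M * ε * ‖x‖) → (∀ j, |f j - fhat j| ≤ M * ε) →
        (gram C (stack Lhat)).IsInvertible ∧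
        ∃ μhat : Measure H,
          IsNormal μhat (postMean a C (stack Lhat) fhat) (postCov C (stack Lhat)) ∧
          W2 μbar μhat ≤ ENNReal.ofReal
            (robustConst a C (stack L) (stack Lhat) f * (M * ε * √d) + K * ε ^ 2) ∧
          W2 μbar μhat ^ 2 ≤ ENNReal.ofReal
            (robustConst a C (stack L) (stack Lhat) f * (M * ε * √d) + K * ε ^ 2) := by
  have hG := gram_isInvertible hpos (stack_adjoint_injective hL)
  obtain ⟨K, η₀, hη₀, h⟩ := hμ.exists_posterior_robust hG f
  -- For `d = 0` the sign of `M` is unknown, but the product vanishes.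
  have hMd : 0 ≤ M * √d := by
    rcases Nat.eq_zero_or_pos d with rfl | hd
    · simp
    · exact mul_nonneg (hM hd) (Real.sqrt_nonneg _)
  -- From `η = M ε √d`; the added 1 keeps the denominator positive when `M √d = 0`.
  refine ⟨_, hμ.map_postMap hG f, K * (M * √d) ^ 2, η₀ / (M * √d + 1), by positivity,
    fun ε hε hlt Lhat fhat hLhat hfhat => ?_⟩
  have hlt' : ε * (M * √d + 1) < η₀ := (lt_div_iff₀ (by positivity)).1 hlt
  have hc : 0 < d → 0 ≤ M * ε := fun hd => mul_nonneg (hM hd) hε.le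
  obtain ⟨hG', hW, hone⟩ := h (M * ε * √d) (by nlinarith) (by nlinarith) (stack Lhat) fhat
    (rowSq_le_of_forall_abs_le hLhat hc) (euclidean_norm_le_of_forall_abs_le hc hfhat)
  have hKε : K * (M * √d) ^ 2 * ε ^ 2 = K * (M * ε * √d) ^ 2 := by ring
  rw [hKε]
  refine ⟨hG', _, hμ.map_postMap hG' fhat, hW, le_trans ?_ hW⟩
  -- A distance at most 1 dominates its square.
  have hle : W2 (μ.map (postMap C (stack L) f)) (μ.map (postMap C (stack Lhat) fhat)) ≤ 1 :=
    hW.trans (ENNReal.ofReal_le_one.2 hone)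
  exact pow_le_of_le_one zero_le hle two_ne_zero

/-! ### Errors of the forward and adjoint information caused by `Û`. -/

section Information

variable {𝒰 P : Type*} [NormedAddCommGroup 𝒰] [NormedSpace ℝ 𝒰]
  [NormedAddCommGroup P] [NormedSpace ℝ P]
  {H : Type*} [NormedAddCommGroup H] [InnerProductSpace ℝ H]

theorem abs_fwdFunctional_sub_le {ℱ : Type*} [NormedAddCommGroup ℱ] [NormedSpace ℝ ℱ]
    {F : 𝒰 → P → ℱ} {ev : H →L[ℝ] (P → (P →L[ℝ] 𝒰))} {U Uhat : P → 𝒰}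
    {T : (P →L[ℝ] ℱ) →L[ℝ] ℝ} {p : P} {M ε : ℝ} (hev : ∀ x, ‖ev x p‖ ≤ ‖x‖) (hT : ‖T‖ ≤ M)
    (hU : ‖partialU F (U p) p - partialU F (Uhat p) p‖ ≤ ε) (x : H) :
    |fwdFunctional F ev U T p x - fwdFunctional F ev Uhat T p x| ≤ M * ε * ‖x‖ := by
  have h : fwdFunctional F ev U T p x - fwdFunctional F ev Uhat T p x =
      T ((partialU F (U p) p - partialU F (Uhat p) p) ∘L ev x p) := by
    rw [ContinuousLinearMap.sub_comp, map_sub]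
    rfl
  rw [h, ← Real.norm_eq_abs, mul_assoc]
  exact (T.le_of_opNorm_le hT _).trans (mul_le_mul_of_nonneg_left
    ((ContinuousLinearMap.opNorm_comp_le _ _).trans
      (mul_le_mul hU (hev x) (norm_nonneg _) ((norm_nonneg _).trans hU)))
    ((norm_nonneg T).trans hT))

omit [NormedAddCommGroup 𝒰] [NormedSpace ℝ 𝒰] in
theorem abs_fwdData_sub_le {ℱ : Type*} [NormedAddCommGroup ℱ] [NormedSpace ℝ ℱ] {d : ℕ}
    {F : 𝒰 → P → ℱ} {U Uhat : P → 𝒰} {T : Fin d → (P →L[ℝ] ℱ) →L[ℝ] ℝ} {p : Fin d → P}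
    {M ε : ℝ} {j : Fin d} (hT : ‖T j‖ ≤ M)
    (hU : ‖partialP F (U (p j)) (p j) - partialP F (Uhat (p j)) (p j)‖ ≤ ε) :
    |fwdData F U T p j - fwdData F Uhat T p j| ≤ M * ε := by
  have h : fwdData F U T p j - fwdData F Uhat T p j =
      -T j (partialP F (U (p j)) (p j) - partialP F (Uhat (p j)) (p j)) := by
    rw [map_sub, neg_sub]
    simp only [fwdData]
    ring
  rw [h, abs_neg, ← Real.norm_eq_abs]
  exact ((T j).le_of_opNorm_le hT _).trans
    (mul_le_mul_of_nonneg_left hU ((norm_nonneg (T j)).trans hT))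

omit [NormedAddCommGroup P] [NormedSpace ℝ P] in
theorem abs_adjFunctional_sub_le {ℱ : Type*} [NormedAddCommGroup ℱ] [InnerProductSpace ℝ ℱ]
    {F : 𝒰 → P → ℱ} {ev : H →L[ℝ] (P → ℱ)} {U Uhat : P → 𝒰} {e : 𝒰} {p : P} {M ε : ℝ}
    (hev : ∀ x, ‖ev x p‖ ≤ ‖x‖) (he : ‖e‖ ≤ M)
    (hU : ‖partialU F (U p) p - partialU F (Uhat p) p‖ ≤ ε) (x : H) :
    |adjFunctional F ev U e p x - adjFunctional F ev Uhat e p x| ≤ M * ε * ‖x‖ := by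
  have h : adjFunctional F ev U e p x - adjFunctional F ev Uhat e p x =
      ⟪(partialU F (U p) p - partialU F (Uhat p) p) e, ev x p⟫ := by
    rw [sub_apply, inner_sub_left]
    rfl
  rw [h, mul_comm M ε]
  have hε := (norm_nonneg _).trans hU
  refine (abs_real_inner_le_norm _ _).trans (mul_le_mul ?_ (hev x) (norm_nonneg _)
    (mul_nonneg hε ((norm_nonneg _).trans he)))
  exact (ContinuousLinearMap.le_of_opNorm_le _ hU _).trans (mul_le_mul_of_nonneg_left he hε)

omit [NormedAddCommGroup P] [NormedSpace ℝ P] in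
theorem abs_adjData_sub_le {d : ℕ} {g : 𝒰 → P → ℝ} {U Uhat : P → 𝒰} {e : Fin d → 𝒰}
    {p : Fin d → P} {M ε : ℝ} {j : Fin d} (he : ‖e j‖ ≤ M)
    (hU : ‖partialU g (U (p j)) (p j) - partialU g (Uhat (p j)) (p j)‖ ≤ ε) :
    |adjData g U e p j - adjData g Uhat e p j| ≤ M * ε := by
  have h : adjData g U e p j - adjData g Uhat e p j =
      (partialU g (U (p j)) (p j) - partialU g (Uhat (p j)) (p j)) (e j) := rfl
  rw [h, ← Real.norm_eq_abs, mul_comm]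
  exact (ContinuousLinearMap.le_of_opNorm_le _ hU _).trans
    (mul_le_mul_of_nonneg_left he ((norm_nonneg _).trans hU))

end Information

end ProbSens

end

open ProbSens in
theorem mainTheorem2 {𝒰 P : Type*} [NormedAddCommGroup 𝒰] [NormedSpace ℝ 𝒰] [CompleteSpace 𝒰]
    [NormedAddCommGroup P] [NormedSpace ℝ P] [CompleteSpace P]
    (d : ℕ) (p : Fin d → P) (M : ℝ) :
    -- forward method
    (∀ {ℱ : Type*} [NormedAddCommGroup ℱ] [NormedSpace ℝ ℱ] [CompleteSpace ℱ]
      (F : 𝒰 → P → ℱ) (g : 𝒰 → P → ℝ) (U : P → 𝒰) (_ : IsSensitivityProblem F g U)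
      {H : Type*} [NormedAddCommGroup H] [InnerProductSpace ℝ H] [CompleteSpace H]
      [SecondCountableTopology H] [MeasurableSpace H] [BorelSpace H]
      (ev : H →L[ℝ] (P → (P →L[ℝ] 𝒰))) (_ : Function.Injective ev)
      (_ : ∀ j x, ‖ev x (p j)‖ ≤ ‖x‖)
      (μ : Measure H) (a : H) (C : H →L[ℝ] H) (_ : IsNormal μ a C)
      (_ : ∀ x, x ≠ 0 → 0 < ⟪x, C x⟫)
      (T : Fin d → (P →L[ℝ] ℱ) →L[ℝ] ℝ) (_ : ∀ j, ‖T j‖ < M)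
      (_ : LinearIndependent ℝ fun j => fwdFunctional F ev U (T j) (p j)),
      ∃ μbar : Measure H, IsNormal μbar (postMean a C (fwdInfo F ev U T p) (fwdData F U T p))
          (postCov C (fwdInfo F ev U T p)) ∧
        ∃ K ε₀ : ℝ, 0 < ε₀ ∧ ∀ ε, 0 < ε → ε < ε₀ → ∀ Uhat : P → 𝒰,
          (∀ j, DerivClose F g U Uhat ε (p j)) →
          (gram C (fwdInfo F ev Uhat T p)).IsInvertible ∧
          ∃ μhat : Measure H,
            IsNormal μhat (postMean a C (fwdInfo F ev Uhat T p) (fwdData F Uhat T p))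
              (postCov C (fwdInfo F ev Uhat T p)) ∧
            W2 μbar μhat ≤ ENNReal.ofReal
              (robustConst a C (fwdInfo F ev U T p) (fwdInfo F ev Uhat T p)
                (fwdData F U T p) * (M * ε * √d) + K * ε ^ 2)) ∧
    -- adjoint method
    (∀ {ℱ : Type*} [NormedAddCommGroup ℱ] [InnerProductSpace ℝ ℱ] [CompleteSpace ℱ]
      (F : 𝒰 → P → ℱ) (g : 𝒰 → P → ℝ) (U : P → 𝒰) (_ : IsSensitivityProblem F g U)
      {H : Type*} [NormedAddCommGroup H] [InnerProductSpace ℝ H] [CompleteSpace H]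
      [SecondCountableTopology H] [MeasurableSpace H] [BorelSpace H]
      (ev : H →L[ℝ] (P → ℱ)) (_ : Function.Injective ev)
      (_ : ∀ j x, ‖ev x (p j)‖ ≤ ‖x‖)
      (μ : Measure H) (a : H) (C : H →L[ℝ] H) (_ : IsNormal μ a C)
      (_ : ∀ x, x ≠ 0 → 0 < ⟪x, C x⟫)
      (e : Fin d → 𝒰) (_ : ∀ j, ‖e j‖ < M)
      (_ : LinearIndependent ℝ fun j => adjFunctional F ev U (e j) (p j)),
      ∃ μbar : Measure H, IsNormal μbar (postMean a C (adjInfo F ev U e p) (adjData g U e p))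
          (postCov C (adjInfo F ev U e p)) ∧
        ∃ K ε₀ : ℝ, 0 < ε₀ ∧ ∀ ε, 0 < ε → ε < ε₀ → ∀ Uhat : P → 𝒰,
          (∀ j, DerivClose F g U Uhat ε (p j)) →
          (gram C (adjInfo F ev Uhat e p)).IsInvertible ∧
          ∃ μhat : Measure H,
            IsNormal μhat (postMean a C (adjInfo F ev Uhat e p) (adjData g Uhat e p))
              (postCov C (adjInfo F ev Uhat e p)) ∧
            W2 μbar μhat ≤ ENNReal.ofReal
              (robustConst a C (adjInfo F ev U e p) (adjInfo F ev Uhat e p)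
                (adjData g U e p) * (M * ε * √d) + K * ε ^ 2) ∧
            W2 μbar μhat ^ 2 ≤ ENNReal.ofReal
              (robustConst a C (adjInfo F ev U e p) (adjInfo F ev Uhat e p)
                (adjData g U e p) * (M * ε * √d) + K * ε ^ 2)) := by
  refine ⟨?_, ?_⟩
  · intro ℱ _ _ _ F g U _ H _ _ _ _ _ _ ev _ hev μ a C hμ hpos T hT hind
    obtain ⟨μbar, hbar, K, ε₀, hε₀, h⟩ := hμ.exists_posterior_of_functionals_close hpos hind
      (fwdData F U T p) fun hd => (norm_nonneg (T ⟨0, hd⟩)).trans (hT ⟨0, hd⟩).le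
    refine ⟨μbar, hbar, K, ε₀, hε₀, fun ε hε hlt Uhat hclose => ?_⟩
    obtain ⟨hG, μhat, hhat, hW, -⟩ := h ε hε hlt
      (fun j => fwdFunctional F ev Uhat (T j) (p j)) (fwdData F Uhat T p)
      (fun j => abs_fwdFunctional_sub_le (hev j) (hT j).le (hclose j).F_u)
      fun j => abs_fwdData_sub_le (hT j).le (hclose j).F_p
    exact ⟨hG, μhat, hhat, hW⟩
  · intro ℱ _ _ _ F g U _ H _ _ _ _ _ _ ev _ hev μ a C hμ hpos e he hind
    obtain ⟨μbar, hbar, K, ε₀, hε₀, h⟩ := hμ.exists_posterior_of_functionals_close hpos hind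
      (adjData g U e p) fun hd => (norm_nonneg _).trans (he ⟨0, hd⟩).le
    refine ⟨μbar, hbar, K, ε₀, hε₀, fun ε hε hlt Uhat hclose => ?_⟩
    exact h ε hε hlt (fun j => adjFunctional F ev Uhat (e j) (p j)) (adjData g Uhat e p)
      (fun j => abs_adjFunctional_sub_le (hev j) (he j).le (hclose j).F_u)
      fun j => abs_adjData_sub_le (he j).le (hclose j).g_u
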